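/- **Proposition 2.2 (Uniform estimates).** Let $d,n\in\mathbb N$ and let $A_1,\dots,A_d$ be maps from $\mathbb R^n$ to the real $n\times n$ matrices such that every entry of every $A_j(\cdot)$ is a polynomial and $A_j(\boldsymbol U)$ is symmetric for every $j$ and every $\boldsymbol U\in\mathbb R^n$. For real-valued $\boldsymbol U\in L^2((2\pi\mathbb T)^d)^n$ with Fourier coefficients $\widehat{\boldsymbol U}_{\boldsymbol k}$ and $\sigma\ge 0$ put $|\boldsymbol U|_{H^\sigma}^2=\sum_{\boldsymbol k\in\mathbb Z^d}(1+|\boldsymbol k|^2)^{\sigma}|\widehat{\boldsymbol U}_{\boldsymbol k}|^2\in[0,\infty]$, and let $H^\sigma((2\pi\mathbb T)^d)^n$ be the space of those $\boldsymbol U$ for which this is finite. For $N\in\mathbb N$ let $\mathrm P_N$ be the Fourier multiplier with symbol $\mathbf 1_{\{-N,\dots,N\}^d}$. Given $\boldsymbol U^0$, consider the problem $$\partial_t \boldsymbol U_N+\mathrm P_N\Big(\sum_{j=1}^d A_j(\boldsymbol U_N)\,\partial_{x_j}\boldsymbol U_N\Big)=\boldsymbol 0,\qquad \boldsymbol U_N|_{t=0}=\mathrm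 P_N\boldsymbol U^0. \tag{1}$$ Let $s>d/2+1$. (i) For every $M>0$ there exist $C>0$ and $T>0$, depending only on $s$, $M$ (and on the system $d,n,A_1,\dots,A_d$), such that for every $N\in\mathbb N$ and every $\boldsymbol U^0\in H^s((2\pi\mathbb T)^d)^n$ with $|\boldsymbol U^0|_{H^s}\le M$ there exists a unique maximal-in-time solution $\boldsymbol U_N\in\mathcal C(I_N;H^s((2\pi\mathbb T)^d)^n)$ of (1), where $I_N\ni 0$ is an open interval. Moreover $I_N\supset[0,T/|\boldsymbol U^0|_{H^s}]$, and for all $0\le t\le T/|\boldsymbol U^0|_{H^s}$ $$|\boldsymbol U_N(t)|_{H^s}\le|\boldsymbol U^0|_{H^s}\exp\big(C|\boldsymbol U^0|_{H^s}t\big)\le 2|\boldsymbol U^0|_{H^s}$$ (if $\boldsymbol U^0=\boldsymbol 0$, the interval $[0,T/|\boldsymbol U^0|_{H^s}]$ is read as $[0,\infty)$). (ii) Let $s'\ge s$. For every $N\in\mathbb N$ and every $\boldsymbol U^0\in H^s((2\pi\mathbb T)^d)^n$, the maximal solution $\boldsymbol U_N$ belongs to $\mathcal C^1(I_N;H^{s'}((2\pi\mathbb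 T)^d)^n)$. Moreover, for every $M^*>0$ there exists $C^*>0$, depending only on $s$, $s'$ and $M^*$ (and on the system), such that for every $N\in\mathbb N$, every $\boldsymbol U^0\in H^s((2\pi\mathbb T)^d)^n$ and every $0<T^*\in I_N$ with $\sup_{t\in[0,T^*]}|\boldsymbol U_N(t)|_{H^s}\le M^*$, one has for all $0\le t\le T^*$ $$|\boldsymbol U_N(t)|_{H^{s'}}\le|\boldsymbol U^0|_{H^{s'}}\exp(C^*M^*t)$$ (which is void if $|\boldsymbol U^0|_{H^{s'}}=\infty$). -/

import Mathlib

open MeasureTheory Filter Topology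
open scoped ENNReal

noncomputable section

namespace SpectralSymm

instance instFactTwoPiPos : Fact (0 < 2 * Real.pi) := ⟨Real.two_pi_pos⟩

/-- The torus `(2πT)^d`, the product of `d` circles of length `2π`, with its Lebesgue measure
(`volume`, of total mass `(2π)^d`). -/
abbrev Torus (d : ℕ) : Type := Fin d → AddCircle (2 * Real.pi)

/-- The space `L²((2πT)^d)^n` of (classes of) real vector-valued square-integrable functions. -/
abbrev L2 (d n : ℕ) : Type :=
  Lp (EuclideanSpace ℝ (Fin n)) 2 (volume : Measure (Torus d))

/-- The character `x ↦ exp(i k·x)` of the torus (each factor `fourier (k j) (x j)` is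
`exp(i k_j x_j)` since the circles have length `2π`). -/
def char {d : ℕ} (k : Fin d → ℤ) : C(Torus d, ℂ) where
  toFun x := ∏ j, fourier (k j) (x j)
  continuous_toFun := by fun_prop

/-- The `k`-th Fourier coefficient of the `a`-th component of `F`,
`(2π)^{-d} ∫ F_a(x) exp(-i k·x) dx`. -/
def fourierCoefficient {d n : ℕ} (F : Torus d → EuclideanSpace ℝ (Fin n)) (k : Fin d → ℤ)
    (a : Fin n) : ℂ :=
  ((2 * Real.pi : ℝ) ^ d : ℂ)⁻¹ * ∫ x : Torus d, (F x a : ℂ) * char (-k) x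

/-- The square of the Japanese bracket, `⟨k⟩² = 1 + |k|²`, with the Euclidean norm of `k`. -/
def bracketSq {d : ℕ} (k : Fin d → ℤ) : ℝ := 1 + ∑ j, (k j : ℝ) ^ 2

/-- The Sobolev norm `|U|_{H^s} = (∑_k ⟨k⟩^{2s} |Û_k|²)^{1/2}`, as an element of `[0, ∞]`. -/
def hsNorm {d n : ℕ} (s : ℝ) (U : L2 d n) : ℝ≥0∞ :=
  (∑' k : Fin d → ℤ,
    ENNReal.ofReal (bracketSq k ^ s * ∑ a, ‖fourierCoefficient U k a‖ ^ 2)) ^ (1 / 2 : ℝ)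

/-- `U ∈ H^s((2πT)^d)^n`. -/
def MemHs {d n : ℕ} (s : ℝ) (U : L2 d n) : Prop := hsNorm s U < ∞

/-- `U ∈ C(I; H^s)`. -/
def ContinuousInHs {d n : ℕ} (s : ℝ) (I : Set ℝ) (U : ℝ → L2 d n) : Prop :=
  (∀ t ∈ I, MemHs s (U t)) ∧
    ∀ t ∈ I, Tendsto (fun τ => hsNorm s (U τ - U t)) (𝓝[I] t) (𝓝 0)

/-- `U ∈ C¹(I; H^s)` for an open set `I` of times: `U` is continuous with values in `H^s`, its
difference quotients converge in `H^s` at each time of `I`, and the derivative is continuous with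
values in `H^s`. -/
def ContDiffOneInHs {d n : ℕ} (s : ℝ) (I : Set ℝ) (U : ℝ → L2 d n) : Prop :=
  ContinuousInHs s I U ∧ ∃ V : ℝ → L2 d n, ContinuousInHs s I V ∧
    ∀ t ∈ I, Tendsto (fun h : ℝ => hsNorm s (h⁻¹ • (U (t + h) - U t) - V t)) (𝓝[≠] 0) (𝓝 0)

/-- The frequencies `⟦-N, N⟧^d`. -/
def box (d N : ℕ) : Finset (Fin d → ℤ) := Fintype.piFinset fun _ => Finset.Icc (-(N : ℤ)) N

/-- The function `∑_{k ∈ ⟦-N,N⟧^d} F̂_k exp(i k·x)`. The sum is real, because `F` is real-valued and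
the set of frequencies is symmetric; `re` only turns it into a real number. -/
def sharpFilterFun {d n : ℕ} (N : ℕ) (F : Torus d → EuclideanSpace ℝ (Fin n)) :
    C(Torus d, EuclideanSpace ℝ (Fin n)) where
  toFun x := WithLp.toLp 2 fun a => (∑ k ∈ box d N, fourierCoefficient F k a * char k x).re
  continuous_toFun := by fun_prop

/-- The sharp low-pass filter `P_N`, the Fourier multiplier with symbol `1_{⟦-N,N⟧^d}`. -/
def sharpFilter {d n : ℕ} (N : ℕ) (F : Torus d → EuclideanSpace ℝ (Fin n)) : L2 d n :=
  ContinuousMap.toLp 2 volume ℝ (sharpFilterFun N F)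

/-- `V = ∂_{x_j} U` in the weak sense, for `U, V ∈ L²`: tested against all characters, that is,
`V̂_k = i k_j Û_k` for every `k`. -/
def IsPartialDeriv {d n : ℕ} (j : Fin d) (U V : L2 d n) : Prop :=
  ∀ k a, fourierCoefficient V k a = Complex.I * (k j : ℂ) * fourierCoefficient U k a

/-- The function `x ↦ ∑_j A_j(U(x)) W_j(x)`. -/
def quasilinearTerm {d n : ℕ}
    (A : Fin d → EuclideanSpace ℝ (Fin n) → Matrix (Fin n) (Fin n) ℝ)
    (U : L2 d n) (W : Fin d → L2 d n) (x : Torus d) : EuclideanSpace ℝ (Fin n) :=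
  ∑ j, WithLp.toLp 2 (Matrix.mulVec (A j (U x)) (WithLp.ofLp (W j x)))

/-- `U ∈ C(I; H^s)` is a solution, on the open interval `I ∋ 0`, of
`∂_t U + P_N (∑_j A_j(U) ∂_{x_j} U) = 0`, `U|_{t=0} = P_N U⁰`. The time derivative exists at every
time of `I`, in `L²`, and the equation holds in `L²` at every time of `I`. Only the restriction of
`U` to `I` matters. -/
structure IsSolution {d n : ℕ}
    (A : Fin d → EuclideanSpace ℝ (Fin n) → Matrix (Fin n) (Fin n) ℝ)
    (s : ℝ) (N : ℕ) (U₀ : L2 d n) (I : Set ℝ) (U : ℝ → L2 d n) : Prop where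
  isOpen : IsOpen I
  isInterval : I.OrdConnected
  zero_mem : (0 : ℝ) ∈ I
  continuousInHs : ContinuousInHs s I U
  initial : U 0 = sharpFilter N U₀
  equation : ∀ t ∈ I, ∃ W : Fin d → L2 d n, (∀ j, IsPartialDeriv j (U t) (W j)) ∧
    HasDerivAt U (-sharpFilter N (quasilinearTerm A (U t) W)) t

/-- A maximal-in-time solution: one that has no extension to a strictly larger open interval. -/
def IsMaximalSolution {d n : ℕ}
    (A : Fin d → EuclideanSpace ℝ (Fin n) → Matrix (Fin n) (Fin n) ℝ)
    (s : ℝ) (N : ℕ) (U₀ : L2 d n) (I : Set ℝ) (U : ℝ → L2 d n) : Prop :=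
  IsSolution A s N U₀ I U ∧
    ∀ (J : Set ℝ) (V : ℝ → L2 d n), IsSolution A s N U₀ J V → I ⊆ J → Set.EqOn V U I → J = I

end SpectralSymm

end

/-!
The filtered system is an ordinary differential equation `U' = F U` on `L²` whose vector field `F`
is `C¹`, because it is polynomial in the finitely many Fourier coefficients in the box
(`contDiff_filteredField`). By completeness of the characters (`ext_fourierCoefficient`) its flow
lines starting from low-pass data are exactly the solutions (`IsSolution.isFlowLine`,
`IsFlowLine.isSolution`). General theory then yields a greatest interval of existence, which can
only end if the solution leaves every compact set (`exists_greatest_isFlowLine`,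
`mem_of_forall_mem_isCompact`). Low-pass functions form a finite-dimensional space, so a bound on
one Sobolev norm is enough to continue, and all Sobolev norms are controlled qualitatively by `L²`.

What matters is that the bounds do not depend on `N`. As `P_N U = U`, the filter disappears from
the `H^σ` energy product, which in terms of coefficients is a trilinear sum. Symmetry of the
matrices and reality of the functions allow for exchanging the two frequencies, and twice the real
part becomes a sum against the kernel `⟨k⟩^{2σ} m_j - ⟨m⟩^{2σ} k_j` (`two_re_energy_eq`). This kernel
is at most a constant times
`⟨k-m⟩ ⟨k⟩^σ ⟨m⟩^σ + ⟨k⟩^σ ⟨k-m⟩^σ ⟨m⟩ + ⟨m⟩^σ ⟨k-m⟩^σ ⟨k⟩` (`abs_kernel_le`),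
so that in each term Young's inequality puts one factor in the Wiener algebra `∑ ⟨k⟩ |f_k|` and the
two others in `H^σ`. It vanishes for `k = m`: the constant parts of the matrices do not contribute,
and only `A_j(U) - A_j(0)` matters, which is bounded linearly in `U` in both norms
(`exists_aeval_sub_le`). Since `H^s` embeds in the Wiener algebra for `s > d/2 + 1`
(`exists_wienerLE_truncation`), the energies satisfy `|(|U|²_{H^σ})'| ≤ K |U|_{H^s} |U|²_{H^σ}`
with `K` depending only on a bound for `|U|_{H^s}` (`exists_abs_deriv_boxEnergy_le`). For `σ = s`
comparison with an exponential barrier bounds the solution on a time of order `1 / |U⁰|_{H^s}`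
(`IsFlowLine.boxEnergy_le_exp`); for `σ = s'` Grönwall's inequality propagates regularity.
-/

noncomputable section

namespace SpectralSymm

/-! ### Maximal solutions of autonomous ordinary differential equations -/

section ODE

variable {E : Type*} [NormedAddCommGroup E] [NormedSpace ℝ E]

/-- `u` solves the autonomous equation `u' = F u`, `u 0 = x₀`, on the open interval `I ∋ 0`. -/
structure IsFlowLine (F : E → E) (x₀ : E) (I : Set ℝ) (u : ℝ → E) : Prop where
  isOpen : IsOpen I
  isInterval : I.OrdConnected
  zero_mem : (0 : ℝ) ∈ I
  initial : u 0 = x₀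
  hasDerivAt : ∀ t ∈ I, HasDerivAt u (F (u t)) t

variable {F : E → E} {x₀ : E} {I J : Set ℝ} {u v : ℝ → E}

/-- Local uniqueness, where only local Lipschitz continuity of `F` is available. -/
theorem eventuallyEq_of_hasDerivAt (hF : ContDiff ℝ 1 F) {t₀ : ℝ}
    (hu : ∀ᶠ t in 𝓝 t₀, HasDerivAt u (F (u t)) t) (hv : ∀ᶠ t in 𝓝 t₀, HasDerivAt v (F (v t)) t)
    (h : u t₀ = v t₀) : u =ᶠ[𝓝 t₀] v := by
  obtain ⟨K, s, hs, hK⟩ := (hF.contDiffAt (x := u t₀)).exists_lipschitzOnWith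
  have hus : ∀ᶠ t in 𝓝 t₀, u t ∈ s := hu.self_of_nhds.continuousAt hs
  have hvs : ∀ᶠ t in 𝓝 t₀, v t ∈ s := hv.self_of_nhds.continuousAt (h ▸ hs)
  exact ODE_solution_unique_of_eventually (v := fun _ => F) (s := fun _ => s) (K := K)
    (Eventually.of_forall fun _ => hK) (hu.and hus) (hv.and hvs) h

/-- Uniqueness: the times near which two solutions agree form an open and closed subset of the
common interval of existence. -/
theorem eqOn_of_hasDerivAt (hF : ContDiff ℝ 1 F) (hI : IsOpen I) (hI' : I.OrdConnected) {t₀ : ℝ}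
    (ht₀ : t₀ ∈ I) (hu : ∀ t ∈ I, HasDerivAt u (F (u t)) t)
    (hv : ∀ t ∈ I, HasDerivAt v (F (v t)) t) (h : u t₀ = v t₀) : Set.EqOn u v I := by
  have ev : ∀ {w : ℝ → E}, (∀ t ∈ I, HasDerivAt w (F (w t)) t) → ∀ t ∈ I,
      ∀ᶠ t' in 𝓝 t, HasDerivAt w (F (w t')) t' := fun hw t ht => by
    filter_upwards [hI.mem_nhds ht] with t' ht' using hw t' ht'
  have key : I ⊆ {t | u =ᶠ[𝓝 t] v} := by
    refine hI'.isPreconnected.subset_of_closure_inter_subset ?_ ?_ ?_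
    · exact isOpen_iff_mem_nhds.2 fun t ht => eventually_eventually_nhds.2 ht
    · exact ⟨t₀, ht₀, eventuallyEq_of_hasDerivAt hF (ev hu _ ht₀) (ev hv _ ht₀) h⟩
    · rintro t ⟨htc, ht⟩
      refine eventuallyEq_of_hasDerivAt hF (ev hu _ ht) (ev hv _ ht) ?_
      by_contra hne
      have := ((hu t ht).continuousAt.prodMk (hv t ht).continuousAt).eventually
        (isClosed_diagonal.isOpen_compl.mem_nhds (show (u t, v t) ∈ (Set.diagonal E)ᶜ from hne))
      obtain ⟨t', h1, h2⟩ := ((mem_closure_iff_frequently.1 htc).and_eventually this).exists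
      exact h2 h1.self_of_nhds
  exact fun t ht => (key ht).self_of_nhds

theorem IsFlowLine.eqOn_inter (hF : ContDiff ℝ 1 F) (hu : IsFlowLine F x₀ I u)
    (hv : IsFlowLine F x₀ J v) : Set.EqOn u v (I ∩ J) :=
  eqOn_of_hasDerivAt hF (hu.isOpen.inter hv.isOpen) (hu.isInterval.inter hv.isInterval)
    ⟨hu.zero_mem, hv.zero_mem⟩ (fun t ht => hu.hasDerivAt t ht.1) (fun t ht => hv.hasDerivAt t ht.2)
    (hu.initial.trans hv.initial.symm)

/-- The solution defined on the largest interval: the union of all intervals of existence. -/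
theorem exists_greatest_isFlowLine [CompleteSpace E] (hF : ContDiff ℝ 1 F) (x₀ : E) :
    ∃ (I : Set ℝ) (u : ℝ → E), IsFlowLine F x₀ I u ∧
      ∀ (J : Set ℝ) (v : ℝ → E), IsFlowLine F x₀ J v → J ⊆ I ∧ Set.EqOn v u J := by
  classical
  set S : Set (Set ℝ) := {J | ∃ v, IsFlowLine F x₀ J v} with hS
  let u : ℝ → E := fun t => if h : ∃ J v, IsFlowLine F x₀ J v ∧ t ∈ J then
    h.choose_spec.choose t else 0
  have hu : ∀ J v, IsFlowLine F x₀ J v → Set.EqOn u v J := by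
    intro J v hv t ht
    have h : ∃ J v, IsFlowLine F x₀ J v ∧ t ∈ J := ⟨J, v, hv, ht⟩
    simp only [u, dif_pos h]
    exact h.choose_spec.choose_spec.1.eqOn_inter hF hv ⟨h.choose_spec.choose_spec.2, ht⟩
  obtain ⟨α, hα, ε, hε, hα'⟩ := (hF.contDiffAt
    (x := x₀)).exists_forall_mem_closedBall_exists_eq_forall_mem_Ioo_hasDerivAt₀ 0
  have hloc : IsFlowLine F x₀ (Set.Ioo (0 - ε) (0 + ε)) α :=
    ⟨isOpen_Ioo, Set.ordConnected_Ioo, ⟨by linarith, by linarith⟩, hα, hα'⟩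
  refine ⟨⋃₀ S, u, ⟨?_, ?_, ?_, ?_, ?_⟩, fun J v hv => ⟨Set.subset_sUnion_of_mem ⟨v, hv⟩,
    (hu J v hv).symm⟩⟩
  · exact isOpen_sUnion fun J ⟨v, hv⟩ => hv.isOpen
  · exact (isPreconnected_sUnion 0 S (fun J ⟨v, hv⟩ => hv.zero_mem)
      (fun J ⟨v, hv⟩ => hv.isInterval.isPreconnected)).ordConnected
  · exact ⟨_, ⟨α, hloc⟩, hloc.zero_mem⟩
  · rw [hu _ _ hloc hloc.zero_mem, hα]
  · rintro t ⟨J, ⟨v, hv⟩, ht⟩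
    rw [hu J v hv ht]
    exact (hv.hasDerivAt t ht).congr_of_eventuallyEq
      (eventually_of_mem (hv.isOpen.mem_nhds ht) (hu J v hv))

/-- Starting points in a compact set have a common time of existence. -/
theorem exists_uniform_time_of_isCompact [CompleteSpace E] (hF : ContDiff ℝ 1 F) {K : Set E}
    (hK : IsCompact K) : ∃ ε > (0 : ℝ), ∀ x ∈ K, ∀ t₀ : ℝ, ∃ α : ℝ → E, α t₀ = x ∧
      ∀ t ∈ Set.Ioo (t₀ - ε) (t₀ + ε), HasDerivAt α (F (α t)) t := by
  refine IsCompact.induction_on hK (p := fun K => ∃ ε > (0 : ℝ), ∀ x ∈ K, ∀ t₀ : ℝ, ∃ α : ℝ → E,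
    α t₀ = x ∧ ∀ t ∈ Set.Ioo (t₀ - ε) (t₀ + ε), HasDerivAt α (F (α t)) t) ?_ ?_ ?_ ?_
  · exact ⟨1, one_pos, by simp⟩
  · intro s t hst ih
    obtain ⟨ε, hε, h⟩ := ih
    exact ⟨ε, hε, fun x hx => h x (hst hx)⟩
  · intro s t hs ht
    obtain ⟨ε, hε, h⟩ := hs
    obtain ⟨δ, hδ, h'⟩ := ht
    refine ⟨min ε δ, lt_min hε hδ, ?_⟩
    rintro x (hx | hx) t₀
    · obtain ⟨α, h1, h2⟩ := h x hx t₀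
      exact ⟨α, h1, fun t ht => h2 t ⟨by linarith [ht.1, min_le_left ε δ],
        by linarith [ht.2, min_le_left ε δ]⟩⟩
    · obtain ⟨α, h1, h2⟩ := h' x hx t₀
      exact ⟨α, h1, fun t ht => h2 t ⟨by linarith [ht.1, min_le_right ε δ],
        by linarith [ht.2, min_le_right ε δ]⟩⟩
  · intro x hx
    obtain ⟨r, hr, ε, hε, h⟩ := (hF.contDiffAt
      (x := x)).exists_forall_mem_closedBall_exists_eq_forall_mem_Ioo_hasDerivAt 0
    refine ⟨Metric.closedBall x r, mem_nhdsWithin_of_mem_nhds (Metric.closedBall_mem_nhds x hr),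
      ε, hε, fun y hy t₀ => ?_⟩
    obtain ⟨α, h1, h2⟩ := h y hy
    refine ⟨fun t => α (t - t₀), by simpa using h1, fun t ht => ?_⟩
    have := h2 (t - t₀) ⟨by linarith [ht.1], by linarith [ht.2]⟩
    simpa using this.comp_sub_const t t₀

/-- Blow-up alternative: the greatest solution exists as long as it stays in a compact set. -/
theorem mem_of_forall_mem_isCompact [CompleteSpace E] (hF : ContDiff ℝ 1 F)
    (hu : IsFlowLine F x₀ I u)
    (hmax : ∀ (J : Set ℝ) (v : ℝ → E), IsFlowLine F x₀ J v → J ⊆ I) {K : Set E}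
    (hK : IsCompact K) {b : ℝ} (hb : 0 ≤ b) (h : ∀ t ∈ I, 0 ≤ t → t ≤ b → u t ∈ K) : b ∈ I := by
  classical
  obtain ⟨ε, hε, hloc⟩ := exists_uniform_time_of_isCompact hF hK
  have step : ∀ t ∈ I, 0 ≤ t → t ≤ b → Set.Ioo (t - ε) (t + ε) ⊆ I := by
    intro t ht ht0 htb
    obtain ⟨α, hα, hα'⟩ := hloc _ (h t ht ht0 htb) t
    have htJ : t ∈ Set.Ioo (t - ε) (t + ε) := ⟨by linarith, by linarith⟩
    -- The local solution through `u t` glues with `u` to a solution on a larger interval.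
    have heq : Set.EqOn u α (I ∩ Set.Ioo (t - ε) (t + ε)) :=
      eqOn_of_hasDerivAt hF (hu.isOpen.inter isOpen_Ioo) (hu.isInterval.inter Set.ordConnected_Ioo)
        ⟨ht, htJ⟩ (fun t' h' => hu.hasDerivAt t' h'.1) (fun t' h' => hα' t' h'.2) hα.symm
    let w : ℝ → E := fun t' => if t' ∈ I then u t' else α t'
    have hw1 : Set.EqOn w u I := fun t' h' => if_pos h'
    have hw2 : Set.EqOn w α (Set.Ioo (t - ε) (t + ε)) := fun t' h' => by
      by_cases h'' : t' ∈ I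
      · exact (if_pos h'').trans (heq ⟨h'', h'⟩)
      · exact if_neg h''
    have hsol : IsFlowLine F x₀ (I ∪ Set.Ioo (t - ε) (t + ε)) w := by
      refine ⟨hu.isOpen.union isOpen_Ioo, ?_, Or.inl hu.zero_mem, ?_, ?_⟩
      · exact (IsPreconnected.union t ht htJ hu.isInterval.isPreconnected
          isPreconnected_Ioo).ordConnected
      · rw [hw1 hu.zero_mem, hu.initial]
      · rintro t' (h' | h')
        · rw [hw1 h']
          exact (hu.hasDerivAt t' h').congr_of_eventuallyEq
            (eventually_of_mem (hu.isOpen.mem_nhds h') hw1)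
        · rw [hw2 h']
          exact (hα' t' h').congr_of_eventuallyEq
            (eventually_of_mem (isOpen_Ioo.mem_nhds h') hw2)
    exact Set.subset_union_right.trans (hmax _ _ hsol)
  -- Steps of length `ε / 2` reach `b` after finitely many extensions.
  have hn : ∀ n : ℕ, min b (n * (ε / 2)) ∈ I := by
    intro n
    induction n with
    | zero => simpa [hb] using hu.zero_mem
    | succ n ih =>
      have h0 : 0 ≤ (n : ℝ) * (ε / 2) := by positivity
      refine step _ ih (le_min hb h0) (min_le_left _ _) ⟨?_, ?_⟩
      · have : min b (n * (ε / 2)) ≤ min b ((n + 1 : ℕ) * (ε / 2)) :=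
          min_le_min le_rfl (by push_cast; nlinarith)
        linarith
      · rcases le_total b (n * (ε / 2)) with h1 | h1
        · rw [min_eq_left h1]
          linarith [min_le_left b ((n + 1 : ℕ) * (ε / 2))]
        · rw [min_eq_right h1]
          have := min_le_right b ((n + 1 : ℕ) * (ε / 2))
          push_cast at this ⊢
          linarith
  obtain ⟨n, hn'⟩ := exists_nat_ge (b / (ε / 2))
  have := hn n
  rwa [min_eq_left ((div_le_iff₀ (by positivity)).1 hn')] at this

end ODE

/-! ### Characters -/

section Characters

variable {d : ℕ}

theorem char_apply (k : Fin d → ℤ) (x : Torus d) : char k x = ∏ j, fourier (k j) (x j) := rfl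

theorem char_zero : char (0 : Fin d → ℤ) = 1 := by
  ext x
  simp [char_apply]

theorem char_add (k m : Fin d → ℤ) : char (k + m) = char k * char m := by
  ext x
  simp [char_apply, Finset.prod_mul_distrib]

theorem char_neg_apply (k : Fin d → ℤ) (x : Torus d) :
    char (-k) x = (starRingEnd ℂ) (char k x) := by
  simp [char_apply]

theorem integral_fourier (m : ℤ) :
    ∫ x : AddCircle (2 * Real.pi), (fourier m x : ℂ) =
      if m = 0 then ((2 * Real.pi : ℝ) : ℂ) else 0 := by
  split_ifs with h
  · subst h
    simp [measureReal_def, AddCircle.measure_univ, Real.pi_pos.le]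
  · exact integral_eq_zero_of_add_right_eq_neg
      (g := ((2 * Real.pi / 2 / m : ℝ) : AddCircle (2 * Real.pi)))
      (fun x => fourier_add_half_inv_index h Real.two_pi_pos x)

theorem integral_char (k : Fin d → ℤ) :
    ∫ x : Torus d, char k x = if k = 0 then ((2 * Real.pi : ℝ) ^ d : ℂ) else 0 := by
  simp only [char_apply]
  rw [MeasureTheory.integral_fintype_prod_volume_eq_prod]
  simp only [integral_fourier]
  split_ifs with h
  · simp [h]
  · obtain ⟨i, hi⟩ := Function.ne_iff.1 h
    exact Finset.prod_eq_zero (Finset.mem_univ i) (if_neg hi)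

/-- The span of the characters is a unital star subalgebra separating points, hence dense. -/
theorem span_char_topologicalClosure :
    (Submodule.span ℂ (Set.range (char (d := d)))).topologicalClosure = ⊤ := by
  have hstar : ∀ f ∈ Algebra.adjoin ℂ (Set.range (char (d := d))),
      star f ∈ Algebra.adjoin ℂ (Set.range (char (d := d))) := by
    intro f hf
    have : Algebra.adjoin ℂ (Set.range (char (d := d))) ≤
        star (Algebra.adjoin ℂ (Set.range (char (d := d)))) := by
      refine Algebra.adjoin_le ?_
      rintro _ ⟨k, rfl⟩
      refine Algebra.subset_adjoin ⟨-k, ?_⟩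
      ext x
      simp [char_neg_apply]
    exact this hf
  let S : StarSubalgebra ℂ C(Torus d, ℂ) :=
    { toSubalgebra := Algebra.adjoin ℂ (Set.range char), star_mem' := fun {f} hf => hstar f hf }
  have hS : S.toSubalgebra.toSubmodule = Submodule.span ℂ (Set.range (char (d := d))) := by
    apply Algebra.adjoin_eq_span_of_subset
    refine .trans (fun x ↦ Submonoid.closure_induction (fun _ ↦ id) ⟨0, char_zero⟩ ?_)
      Submodule.subset_span
    rintro _ _ _ _ ⟨m, rfl⟩ ⟨n, rfl⟩
    exact ⟨m + n, char_add m n⟩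
  have hsep : S.SeparatesPoints := by
    intro x y hxy
    obtain ⟨i, hi⟩ := Function.ne_iff.1 hxy
    have hs : ∀ z : Torus d, char (Pi.single i 1) z = (z i).toCircle := by
      intro z
      rw [char_apply, Finset.prod_eq_single i]
      · simp
      · intro j _ hj
        simp [hj]
      · simp
    refine ⟨_, ⟨char (Pi.single i 1), Algebra.subset_adjoin ⟨_, rfl⟩, rfl⟩, ?_⟩
    simp only [hs]
    contrapose hi
    exact AddCircle.injective_toCircle Real.two_pi_pos.ne' (Subtype.ext hi)
  have := ContinuousMap.starSubalgebra_topologicalClosure_eq_top_of_separatesPoints S hsep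
  rw [← hS]
  exact congr_arg (Subalgebra.toSubmodule <| StarSubalgebra.toSubalgebra ·) this

theorem span_toLp_char_topologicalClosure :
    (Submodule.span ℂ (Set.range fun k : Fin d → ℤ =>
      ContinuousMap.toLp (E := ℂ) 2 (volume : Measure (Torus d)) ℂ (char k))).topologicalClosure
      = ⊤ := by
  simpa only [Submodule.map_span, ContinuousLinearMap.coe_coe, ← Set.range_comp,
    Function.comp_def] using
    (ContinuousMap.toLp_denseRange ℂ (volume : Measure (Torus d)) ℂ
      (by simp)).topologicalClosure_map_submodule
      span_char_topologicalClosure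

end Characters

/-! ### Trigonometric polynomials -/

section Trig

variable {d : ℕ}

/-- The algebra of trigonometric polynomials, through their (finitely many) Fourier coefficients;
the product is the convolution of the coefficients. -/
abbrev TrigPoly (d : ℕ) : Type := AddMonoidAlgebra ℂ (Fin d → ℤ)

/-- The function `x ↦ ∑_k f_k exp(i k·x)` defined by a trigonometric polynomial. -/
def trig : TrigPoly d →ₐ[ℂ] C(Torus d, ℂ) :=
  AddMonoidAlgebra.lift ℂ _ _
    { toFun := fun k => char (Multiplicative.toAdd k)
      map_one' := char_zero
      map_mul' := fun _ _ => char_add _ _ }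

theorem trig_single (k : Fin d → ℤ) (z : ℂ) :
    trig (AddMonoidAlgebra.single k z) = z • char k := by
  simp [trig, AddMonoidAlgebra.lift_single]

/-- Orthogonality of the characters: integration recovers the coefficients. -/
theorem integral_trig_mul_char_neg (f : TrigPoly d) (k : Fin d → ℤ) :
    ((2 * Real.pi : ℝ) ^ d : ℂ)⁻¹ * ∫ x : Torus d, trig f x * char (-k) x = f.coeff k := by
  have hint : ∀ g : C(Torus d, ℂ), Integrable (fun x => g x * char (-k) x) := fun g =>
    (g.continuous.mul (char (-k)).continuous).integrable_of_hasCompactSupport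
      (HasCompactSupport.of_compactSpace _)
  induction f using AddMonoidAlgebra.induction_linear with
  | zero => simp
  | add f g hf hg =>
    simp only [map_add, ContinuousMap.add_apply, add_mul]
    rw [integral_add (hint _) (hint _), mul_add, hf, hg]
    simp
  | single m z =>
    have : ∀ x : Torus d, trig (AddMonoidAlgebra.single m z) x * char (-k) x =
        z * char (m - k) x := by
      intro x
      rw [trig_single, sub_eq_add_neg, char_add]
      simp [mul_assoc]
    simp only [this]
    rw [integral_const_mul, integral_char]
    have h0 : ((2 * Real.pi : ℝ) ^ d : ℂ) ≠ 0 := by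
      exact_mod_cast pow_ne_zero _ Real.two_pi_pos.ne'
    simp only [sub_eq_zero, AddMonoidAlgebra.coeff_single, Finsupp.single_apply]
    split_ifs with h
    · field_simp
    · simp

/-- Real-valued trigonometric polynomials have conjugate-symmetric coefficients. -/
theorem coeff_neg_of_real {f : TrigPoly d} {g : Torus d → ℝ} (h : ∀ x, trig f x = (g x : ℂ))
    (k : Fin d → ℤ) : f.coeff (-k) = (starRingEnd ℂ) (f.coeff k) := by
  rw [← integral_trig_mul_char_neg f k, ← integral_trig_mul_char_neg f (-k), map_mul,
    ← integral_conj]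
  simp [h, char_neg_apply, map_ofNat]

end Trig

/-! ### Fourier coefficients of square-integrable functions -/

section Coefficients

variable {d n : ℕ}

theorem fourierCoefficient_neg (F : Torus d → EuclideanSpace ℝ (Fin n)) (k : Fin d → ℤ)
    (a : Fin n) : fourierCoefficient F (-k) a = (starRingEnd ℂ) (fourierCoefficient F k a) := by
  unfold fourierCoefficient
  rw [map_mul, ← integral_conj]
  simp [char_neg_apply, map_ofNat]

theorem fourierCoefficient_of_trig {F : Torus d → EuclideanSpace ℝ (Fin n)} {f : TrigPoly d}
    {a : Fin n} (h : ∀ᵐ x, (F x a : ℂ) = trig f x) (k : Fin d → ℤ) :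
    fourierCoefficient F k a = f.coeff k := by
  rw [← integral_trig_mul_char_neg]
  unfold fourierCoefficient
  congr 1
  refine integral_congr_ae ?_
  filter_upwards [h] with x hx
  rw [hx]

/-- The `a`-th component of an element of `L²`, as a complex-valued function. -/
def complexComponent (a : Fin n) : L2 d n →L[ℝ] Lp ℂ 2 (volume : Measure (Torus d)) :=
  ContinuousLinearMap.compLpL 2 volume
    (Complex.ofRealCLM ∘L (EuclideanSpace.proj a : EuclideanSpace ℝ (Fin n) →L[ℝ] ℝ))

theorem coeFn_complexComponent (a : Fin n) (u : L2 d n) :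
    complexComponent a u =ᵐ[volume] fun x => ((u x a : ℝ) : ℂ) :=
  ContinuousLinearMap.coeFn_compLp _ u

/-- The Fourier coefficient as a continuous linear functional on `L²`. -/
def coeffL (k : Fin d → ℤ) (a : Fin n) : L2 d n →L[ℝ] ℂ :=
  ((2 * Real.pi : ℝ) ^ d)⁻¹ •
    (((innerSL ℂ (ContinuousMap.toLp (E := ℂ) 2 (volume : Measure (Torus d)) ℂ (char k))
      ).restrictScalars ℝ) ∘L complexComponent a)

theorem coeffL_apply (k : Fin d → ℤ) (a : Fin n) (u : L2 d n) :
    coeffL k a u = fourierCoefficient u k a := by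
  simp only [coeffL, smul_apply, ContinuousLinearMap.comp_apply,
    ContinuousLinearMap.coe_restrictScalars', innerSL_apply_apply, fourierCoefficient,
    Complex.real_smul]
  push_cast
  congr 1
  rw [L2.inner_def]
  refine integral_congr_ae ?_
  filter_upwards [coeFn_complexComponent a u,
    ContinuousMap.coeFn_toLp (E := ℂ) (p := 2) (𝕜 := ℂ) volume (char k)] with x h1 h2
  rw [h1, h2, char_neg_apply]
  simp

/-- Completeness of the characters in `L²`. -/
theorem ext_fourierCoefficient {u v : L2 d n}
    (h : ∀ k a, fourierCoefficient u k a = fourierCoefficient v k a) : u = v := by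
  rw [← sub_eq_zero]
  have hc : ∀ a, complexComponent a (u - v) = 0 := by
    intro a
    have hmem : complexComponent a (u - v) ∈ (Submodule.span ℂ (Set.range fun k : Fin d → ℤ =>
        ContinuousMap.toLp (E := ℂ) 2 (volume : Measure (Torus d)) ℂ (char k)))ᗮ := by
      rw [Submodule.mem_orthogonal]
      intro w hw
      induction hw using Submodule.span_induction with
      | mem w hw =>
        obtain ⟨k, rfl⟩ := hw
        have h0 : coeffL k a (u - v) = 0 := by
          rw [map_sub, coeffL_apply, coeffL_apply, h, sub_self]
        simp only [coeffL, smul_apply, ContinuousLinearMap.comp_apply,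
          ContinuousLinearMap.coe_restrictScalars', innerSL_apply_apply, smul_eq_zero,
          inv_eq_zero] at h0
        exact h0.resolve_left (pow_ne_zero _ Real.two_pi_pos.ne')
      | zero => simp
      | add x y _ _ hx hy => rw [inner_add_left, hx, hy, add_zero]
      | smul c x _ hx => rw [inner_smul_left, hx, mul_zero]
    rwa [(Submodule.topologicalClosure_eq_top_iff).1 span_toLp_char_topologicalClosure,
      Submodule.mem_bot] at hmem
  rw [Lp.eq_zero_iff_ae_eq_zero]
  have hall : ∀ᵐ x, ∀ a, ((((u - v : L2 d n) : Torus d → _) x a : ℝ) : ℂ) = 0 := by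
    rw [ae_all_iff]
    intro a
    have h1 := coeFn_complexComponent a (u - v)
    rw [hc a] at h1
    filter_upwards [h1, Lp.coeFn_zero ℂ 2 (volume : Measure (Torus d))] with x h2 h3
    rw [← h2, h3]; rfl
  filter_upwards [hall] with x hx
  ext a
  simpa using hx a

end Coefficients

/-! ### Low-pass filter and trigonometric synthesis -/

section Synthesis

variable {d n : ℕ}

theorem neg_mem_box {N : ℕ} {k : Fin d → ℤ} : -k ∈ box d N ↔ k ∈ box d N := by
  simp only [box, Fintype.mem_piFinset, Finset.mem_Icc, Pi.neg_apply]
  exact forall_congr' fun j => ⟨fun h => ⟨by linarith, by linarith⟩,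
    fun h => ⟨by linarith, by linarith⟩⟩

/-- Conjugate symmetry, the property that characterizes the Fourier coefficients of real-valued
functions. -/
def ConjSymm (y : (Fin d → ℤ) → Fin n → ℂ) : Prop :=
  ∀ k a, y (-k) a = (starRingEnd ℂ) (y k a)

theorem conjSymm_fourierCoefficient (F : Torus d → EuclideanSpace ℝ (Fin n)) :
    ConjSymm (fourierCoefficient F) := fourierCoefficient_neg F

theorem ConjSymm.partialDeriv {y : (Fin d → ℤ) → Fin n → ℂ} (hy : ConjSymm y) (j : Fin d) :
    ConjSymm fun k a => Complex.I * (k j : ℂ) * y k a := fun k a => by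
  simp [hy k a]

/-- The trigonometric polynomial with coefficients `y` on the box `⟦-N, N⟧^d`. -/
def truncation (N : ℕ) (y : (Fin d → ℤ) → Fin n → ℂ) (a : Fin n) : TrigPoly d :=
  ∑ k ∈ box d N, AddMonoidAlgebra.single k (y k a)

theorem coeff_truncation (N : ℕ) (y : (Fin d → ℤ) → Fin n → ℂ) (a : Fin n) (k : Fin d → ℤ) :
    (truncation N y a).coeff k = if k ∈ box d N then y k a else 0 := by
  simp [truncation, AddMonoidAlgebra.coeff_sum, Finsupp.finsetSum_apply, Finsupp.single_apply]

theorem trig_truncation (N : ℕ) (y : (Fin d → ℤ) → Fin n → ℂ) (a : Fin n) (x : Torus d) :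
    trig (truncation N y a) x = ∑ k ∈ box d N, y k a * char k x := by
  simp [truncation, trig_single, ContinuousMap.sum_apply]

theorem ConjSymm.ofReal_re_sum {y : (Fin d → ℤ) → Fin n → ℂ} (hy : ConjSymm y) (N : ℕ)
    (a : Fin n) (x : Torus d) :
    (((∑ k ∈ box d N, y k a * char k x).re : ℝ) : ℂ) = trig (truncation N y a) x := by
  rw [trig_truncation, ← Complex.conj_eq_iff_re, map_sum]
  refine Finset.sum_nbij' (fun k => -k) (fun k => -k) (fun k hk => neg_mem_box.2 hk)
    (fun k hk => neg_mem_box.2 hk) (fun k _ => neg_neg k) (fun k _ => neg_neg k) fun k _ => ?_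
  rw [hy, char_neg_apply, map_mul]

/-- The real mode `x ↦ Re (z exp(i k·x)) e_a`, as an element of `L²` depending linearly on `z`. -/
def mode (k : Fin d → ℤ) (a : Fin n) : ℂ →L[ℝ] L2 d n :=
  ContinuousMap.toLp 2 volume ℝ ∘L LinearMap.toContinuousLinearMap
    { toFun := fun z => (⟨fun x => EuclideanSpace.single a (z * char k x).re, by
        have : Continuous fun x : Torus d => (z * char k x).re := by fun_prop
        have h2 : (fun x : Torus d => EuclideanSpace.single a (z * char k x).re) =
          fun x => (z * char k x).re • (EuclideanSpace.single a (1 : ℝ)) := by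
            ext x b; simp
        rw [h2]; fun_prop⟩ : C(Torus d, EuclideanSpace ℝ (Fin n)))
      map_add' := fun z w => by
        ext x b
        by_cases h : b = a <;> simp [h, add_mul]
      map_smul' := fun r z => by
        ext x b
        by_cases h : b = a <;> simp [h, mul_assoc] }

/-- The element of `L²` with (conjugate-symmetric) Fourier coefficients `y` on the box
`⟦-N, N⟧^d`. -/
def synth (N : ℕ) (y : (Fin d → ℤ) → Fin n → ℂ) : L2 d n :=
  ∑ k ∈ box d N, ∑ a, mode k a (y k a)

theorem coeFn_synth (N : ℕ) (y : (Fin d → ℤ) → Fin n → ℂ) :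
    synth N y =ᵐ[volume] fun x => WithLp.toLp 2 fun a => (∑ k ∈ box d N, y k a * char k x).re := by
  let g : C(Torus d, EuclideanSpace ℝ (Fin n)) :=
    ⟨fun x => WithLp.toLp 2 fun a => (∑ k ∈ box d N, y k a * char k x).re, by fun_prop⟩
  have : synth N y = ContinuousMap.toLp 2 volume ℝ g := by
    simp only [synth, mode, ContinuousLinearMap.comp_apply, ← map_sum]
    congr 1
    ext x b
    simp only [ContinuousMap.sum_apply, LinearMap.coe_toContinuousLinearMap', g, WithLp.ofLp_sum,
      LinearMap.coe_mk, AddHom.coe_mk, ContinuousMap.coe_mk, Finset.sum_apply, Complex.re_sum]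
    refine Finset.sum_congr rfl fun k _ => ?_
    rw [Finset.sum_eq_single b]
    · simp
    · intro a _ hab
      simp [hab.symm]
    · simp
  rw [this]
  exact ContinuousMap.coeFn_toLp volume g

theorem sharpFilter_eq_synth (N : ℕ) (F : Torus d → EuclideanSpace ℝ (Fin n)) :
    sharpFilter N F = synth N (fourierCoefficient F) :=
  Lp.ext ((ContinuousMap.coeFn_toLp volume _).trans (coeFn_synth N _).symm)

theorem ConjSymm.coeFn_synth {y : (Fin d → ℤ) → Fin n → ℂ} (hy : ConjSymm y) (N : ℕ) :
    ∀ᵐ x, ∀ a, ((synth N y x a : ℝ) : ℂ) = trig (truncation N y a) x := by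
  filter_upwards [SpectralSymm.coeFn_synth N y] with x hx a
  rw [hx, ← hy.ofReal_re_sum]

theorem ConjSymm.fourierCoefficient_synth {y : (Fin d → ℤ) → Fin n → ℂ} (hy : ConjSymm y) (N : ℕ)
    (k : Fin d → ℤ) (a : Fin n) :
    fourierCoefficient (synth N y) k a = if k ∈ box d N then y k a else 0 := by
  rw [← coeff_truncation]
  exact fourierCoefficient_of_trig ((hy.coeFn_synth N).mono fun x hx => hx a) k

theorem fourierCoefficient_sharpFilter (N : ℕ) (F : Torus d → EuclideanSpace ℝ (Fin n))
    (k : Fin d → ℤ) (a : Fin n) : fourierCoefficient (sharpFilter N F) k a =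
      if k ∈ box d N then fourierCoefficient F k a else 0 := by
  rw [sharpFilter_eq_synth, (conjSymm_fourierCoefficient F).fourierCoefficient_synth]

/-- The low-pass filter as a continuous linear map on `L²`. -/
def lowPass (N : ℕ) : L2 d n →L[ℝ] L2 d n := ∑ k ∈ box d N, ∑ a, mode k a ∘L coeffL k a

theorem lowPass_apply (N : ℕ) (u : L2 d n) : lowPass N u = sharpFilter N u := by
  simp [lowPass, sharpFilter_eq_synth, synth, coeffL_apply]

theorem sharpFilter_sharpFilter (N : ℕ) (F : Torus d → EuclideanSpace ℝ (Fin n)) :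
    sharpFilter N (sharpFilter N F) = sharpFilter N F := by
  refine ext_fourierCoefficient fun k a => ?_
  rw [fourierCoefficient_sharpFilter, fourierCoefficient_sharpFilter]
  split_ifs <;> rfl

end Synthesis

/-! ### The filtered system as a smooth vector field -/

section VectorField

variable {d n : ℕ}

/-- The coefficients of the `a`-th component of `∑_j A_j(U) ∂_{x_j} U` for the trigonometric
polynomial `U` with coefficients `y` on the box, where the `p j` are the polynomial entries of
`A_j`. -/
def quasilinearPoly (p : Fin d → Fin n → Fin n → MvPolynomial (Fin n) ℝ) (N : ℕ)
    (y : (Fin d → ℤ) → Fin n → ℂ) (a : Fin n) : TrigPoly d :=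
  ∑ j, ∑ b, MvPolynomial.aeval (truncation N y) (p j a b) *
    truncation N (fun k b => Complex.I * (k j : ℂ) * y k b) b

/-- The vector field on `L²` whose flow lines starting from low-pass data are the solutions of the
filtered system. It only depends on the Fourier coefficients in the box. -/
def filteredField (p : Fin d → Fin n → Fin n → MvPolynomial (Fin n) ℝ) (N : ℕ) (u : L2 d n) :
    L2 d n :=
  -synth N fun k a => (quasilinearPoly p N (fourierCoefficient u) a).coeff k

/-- Evaluating a polynomial in the algebra of trigonometric polynomials and then at a point is
evaluating it at the (real) values of the functions. -/
theorem trig_aeval {y : (Fin d → ℤ) → Fin n → ℂ} (hy : ConjSymm y) (N : ℕ)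
    (q : MvPolynomial (Fin n) ℝ) (x : Torus d) :
    trig (MvPolynomial.aeval (truncation N y) q) x =
      ((MvPolynomial.eval (fun a => (∑ k ∈ box d N, y k a * char k x).re) q : ℝ) : ℂ) := by
  induction q using MvPolynomial.induction_on with
  | C r =>
    rw [MvPolynomial.aeval_C, MvPolynomial.eval_C,
      IsScalarTower.algebraMap_apply ℝ ℂ (TrigPoly d), AlgHom.commutes]
    simp
  | add q r hq hr => simp [hq, hr]
  | mul_X q i hq =>
    simp only [map_mul, MvPolynomial.aeval_X, MvPolynomial.eval_X, ContinuousMap.mul_apply, hq,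
      Complex.ofReal_mul, hy.ofReal_re_sum]

theorem conjSymm_coeff_aeval {y : (Fin d → ℤ) → Fin n → ℂ} (hy : ConjSymm y) (N : ℕ)
    (q : MvPolynomial (Fin n) ℝ) (k : Fin d → ℤ) :
    (MvPolynomial.aeval (truncation N y) q).coeff (-k) =
      (starRingEnd ℂ) ((MvPolynomial.aeval (truncation N y) q).coeff k) :=
  coeff_neg_of_real (trig_aeval hy N q) k

variable {A : Fin d → EuclideanSpace ℝ (Fin n) → Matrix (Fin n) (Fin n) ℝ}
  {p : Fin d → Fin n → Fin n → MvPolynomial (Fin n) ℝ}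

theorem fourierCoefficient_quasilinearTerm
    (hp : ∀ j a b u, A j u a b = MvPolynomial.eval (fun i => u i) (p j a b))
    {y : (Fin d → ℤ) → Fin n → ℂ} (hy : ConjSymm y) (N : ℕ) (k : Fin d → ℤ) (a : Fin n) :
    fourierCoefficient (quasilinearTerm A (synth N y)
      fun j => synth N fun k b => Complex.I * (k j : ℂ) * y k b) k a =
      (quasilinearPoly p N y a).coeff k := by
  refine fourierCoefficient_of_trig ?_ k
  have hW : ∀ᵐ x, ∀ j b, ((synth N (fun k b => Complex.I * (k j : ℂ) * y k b) x b : ℝ) : ℂ) =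
      trig (truncation N (fun k b => Complex.I * (k j : ℂ) * y k b) b) x :=
    ae_all_iff.2 fun j => (hy.partialDeriv j).coeFn_synth N
  filter_upwards [coeFn_synth N y, hW] with x h1 h2
  simp only [quasilinearTerm, h1, quasilinearPoly, map_sum, map_mul, WithLp.ofLp_sum,
    Finset.sum_apply, Matrix.mulVec, dotProduct, Complex.ofReal_sum, Complex.ofReal_mul, h2,
    ContinuousMap.sum_apply, ContinuousMap.mul_apply, trig_aeval hy, hp]

/-- The vector field is the filtered quasilinear term of the low-pass part of its argument, also
when the argument itself is not low-pass. -/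
theorem filteredField_eq (hp : ∀ j a b u, A j u a b = MvPolynomial.eval (fun i => u i) (p j a b))
    (N : ℕ) (u : L2 d n) : filteredField p N u = -sharpFilter N (quasilinearTerm A
      (sharpFilter N u) fun j => synth N fun k b =>
        Complex.I * (k j : ℂ) * fourierCoefficient u k b) := by
  rw [filteredField, sharpFilter_eq_synth N (quasilinearTerm _ _ _), sharpFilter_eq_synth N u]
  congr 2
  ext k a
  rw [fourierCoefficient_quasilinearTerm hp (conjSymm_fourierCoefficient u)]

theorem fourierCoefficient_filteredField
    (hp : ∀ j a b u, A j u a b = MvPolynomial.eval (fun i => u i) (p j a b))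
    (N : ℕ) (u : L2 d n) {k : Fin d → ℤ} (hk : k ∈ box d N) (a : Fin n) :
    fourierCoefficient (filteredField p N u) k a =
      -(quasilinearPoly p N (fourierCoefficient u) a).coeff k := by
  rw [filteredField_eq hp, ← coeffL_apply, map_neg, coeffL_apply, fourierCoefficient_sharpFilter,
    if_pos hk, sharpFilter_eq_synth,
    fourierCoefficient_quasilinearTerm hp (conjSymm_fourierCoefficient u)]

/-- The coefficients of a product, when the second factor is supported in `S`. -/
theorem coeff_mul_of_support (f g : TrigPoly d) {S : Finset (Fin d → ℤ)}
    (hg : ∀ k ∉ S, g.coeff k = 0) (k : Fin d → ℤ) :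
    (f * g).coeff k = ∑ m ∈ S, f.coeff (k - m) * g.coeff m := by
  rw [AddMonoidAlgebra.coeff_mul_apply_right, Finsupp.sum]
  simp only [sub_eq_add_neg]
  refine Finset.sum_subset (fun m hm => ?_) (fun m _ hm => ?_)
  · by_contra h
    exact (Finsupp.mem_support_iff.1 hm) (hg m h)
  · simp [Finsupp.notMem_support_iff.1 hm]

theorem coeff_truncation_of_notMem (N : ℕ) (y : (Fin d → ℤ) → Fin n → ℂ) (a : Fin n)
    (k : Fin d → ℤ) (hk : k ∉ box d N) : (truncation N y a).coeff k = 0 := by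
  rw [coeff_truncation, if_neg hk]

theorem contDiff_fourierCoefficient (k : Fin d → ℤ) (a : Fin n) :
    ContDiff ℝ 1 fun u : L2 d n => fourierCoefficient u k a := by
  simp only [← coeffL_apply]
  exact (coeffL k a).contDiff

theorem contDiff_coeff_truncation (N : ℕ) (a : Fin n) (k : Fin d → ℤ) :
    ContDiff ℝ 1 fun u : L2 d n => (truncation N (fourierCoefficient u) a).coeff k := by
  simp only [coeff_truncation]
  split_ifs
  · exact contDiff_fourierCoefficient k a
  · exact contDiff_const

theorem contDiff_coeff_aeval (N : ℕ) (q : MvPolynomial (Fin n) ℝ) (k : Fin d → ℤ) :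
    ContDiff ℝ 1 fun u : L2 d n =>
      (MvPolynomial.aeval (truncation N (fourierCoefficient u)) q).coeff k := by
  induction q using MvPolynomial.induction_on generalizing k with
  | C r =>
    simp only [MvPolynomial.aeval_C]
    exact contDiff_const
  | add q r hq hr =>
    simp only [map_add, AddMonoidAlgebra.coeff_add, Finsupp.add_apply]
    exact (hq k).add (hr k)
  | mul_X q i hq =>
    simp only [map_mul, MvPolynomial.aeval_X]
    simp only [coeff_mul_of_support _ _ (coeff_truncation_of_notMem N _ i)]
    exact ContDiff.sum fun m _ => (hq _).mul (contDiff_coeff_truncation N i m)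

theorem contDiff_coeff_quasilinearPoly (N : ℕ) (a : Fin n) (k : Fin d → ℤ) :
    ContDiff ℝ 1 fun u : L2 d n => (quasilinearPoly p N (fourierCoefficient u) a).coeff k := by
  simp only [quasilinearPoly, AddMonoidAlgebra.coeff_sum, Finsupp.finsetSum_apply]
  refine ContDiff.sum fun j _ => ContDiff.sum fun b _ => ?_
  simp only [coeff_mul_of_support _ _ (coeff_truncation_of_notMem N _ b), coeff_truncation]
  refine ContDiff.sum fun m hm => (contDiff_coeff_aeval N _ _).mul ?_
  simp only [if_pos hm]
  exact contDiff_const.mul (contDiff_fourierCoefficient m b)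

theorem contDiff_filteredField : ∀ N : ℕ, ContDiff ℝ 1 (filteredField (d := d) (n := n) p N) :=
  fun N => ContDiff.neg <| ContDiff.sum fun k _ => ContDiff.sum fun a _ =>
    (mode k a).contDiff.comp (contDiff_coeff_quasilinearPoly N a k)

end VectorField

/-! ### Sobolev norms of low-pass functions -/

section Norms

variable {d n : ℕ}

theorem one_le_bracketSq (k : Fin d → ℤ) : 1 ≤ bracketSq k := by
  have : 0 ≤ ∑ j, (k j : ℝ) ^ 2 := by positivity
  unfold bracketSq; linarith

theorem bracketSq_pos (k : Fin d → ℤ) : 0 < bracketSq k := one_pos.trans_le (one_le_bracketSq k)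

/-- The part of the squared `H^s` norm carried by the frequencies of the box. -/
def boxEnergy (s : ℝ) (N : ℕ) (u : L2 d n) : ℝ :=
  ∑ k ∈ box d N, bracketSq k ^ s * ∑ a, ‖fourierCoefficient u k a‖ ^ 2

theorem energy_term_nonneg (s : ℝ) (u : L2 d n) (k : Fin d → ℤ) :
    0 ≤ bracketSq k ^ s * ∑ a, ‖fourierCoefficient u k a‖ ^ 2 :=
  mul_nonneg (Real.rpow_nonneg (bracketSq_pos k).le _) (by positivity)

theorem boxEnergy_nonneg (s : ℝ) (N : ℕ) (u : L2 d n) : 0 ≤ boxEnergy s N u :=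
  Finset.sum_nonneg fun k _ => energy_term_nonneg s u k

theorem ofReal_sqrt_eq_rpow {x : ℝ} (hx : 0 ≤ x) :
    ENNReal.ofReal (√x) = ENNReal.ofReal x ^ (1 / 2 : ℝ) := by
  rw [Real.sqrt_eq_rpow, ENNReal.ofReal_rpow_of_nonneg hx (by norm_num)]

theorem hsNorm_eq_of_lowPass (s : ℝ) {N : ℕ} {u : L2 d n} (hu : sharpFilter N u = u) :
    hsNorm s u = ENNReal.ofReal (√(boxEnergy s N u)) := by
  rw [ofReal_sqrt_eq_rpow (boxEnergy_nonneg _ _ _), hsNorm, boxEnergy,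
    ENNReal.ofReal_sum_of_nonneg fun k _ => energy_term_nonneg s u k]
  congr 1
  refine tsum_eq_sum fun k hk => ?_
  have : ∀ a, fourierCoefficient u k a = 0 := fun a => by
    rw [← hu, fourierCoefficient_sharpFilter, if_neg hk]
  simp [this]

theorem ofReal_sqrt_boxEnergy_le (s : ℝ) (N : ℕ) (u : L2 d n) :
    ENNReal.ofReal (√(boxEnergy s N u)) ≤ hsNorm s u := by
  rw [ofReal_sqrt_eq_rpow (boxEnergy_nonneg _ _ _), hsNorm, boxEnergy,
    ENNReal.ofReal_sum_of_nonneg fun k _ => energy_term_nonneg s u k]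
  gcongr
  exact ENNReal.sum_le_tsum _

theorem boxEnergy_sharpFilter (s : ℝ) (N : ℕ) (u : L2 d n) :
    boxEnergy s N (sharpFilter N u) = boxEnergy s N u := by
  refine Finset.sum_congr rfl fun k hk => ?_
  simp only [fourierCoefficient_sharpFilter, if_pos hk]

theorem continuous_boxEnergy (s : ℝ) (N : ℕ) : Continuous (boxEnergy s N (d := d) (n := n)) := by
  unfold boxEnergy
  simp only [← coeffL_apply]
  fun_prop

theorem boxEnergy_zero (s : ℝ) (N : ℕ) : boxEnergy s N (0 : L2 d n) = 0 := by
  simp only [boxEnergy, ← coeffL_apply, map_zero]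
  simp

theorem tendsto_hsNorm_of_lowPass (s : ℝ) {N : ℕ} {ι : Type*} {l : Filter ι} {w : ι → L2 d n}
    (hw : ∀ᶠ i in l, sharpFilter N (w i) = w i) (h : Tendsto w l (𝓝 0)) :
    Tendsto (fun i => hsNorm s (w i)) l (𝓝 0) := by
  have h1 : Tendsto (fun i => ENNReal.ofReal (√(boxEnergy s N (w i)))) l (𝓝 0) := by
    have := (ENNReal.continuous_ofReal.comp
      (Real.continuous_sqrt.comp (continuous_boxEnergy s N))).tendsto (0 : L2 d n)
    simp only [Function.comp_apply, boxEnergy_zero, Real.sqrt_zero, ENNReal.ofReal_zero] at this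
    exact this.comp h
  refine h1.congr' ?_
  filter_upwards [hw] with i hi using (hsNorm_eq_of_lowPass s hi).symm

theorem continuousInHs_of_lowPass (s : ℝ) {N : ℕ} {I : Set ℝ} {u : ℝ → L2 d n}
    (hu : ∀ t ∈ I, sharpFilter N (u t) = u t) (hc : ContinuousOn u I) : ContinuousInHs s I u := by
  refine ⟨fun t ht => ?_, fun t ht => ?_⟩
  · rw [MemHs, hsNorm_eq_of_lowPass s (hu t ht)]
    exact ENNReal.ofReal_lt_top
  · refine tendsto_hsNorm_of_lowPass (N := N) s ?_ ?_
    · filter_upwards [self_mem_nhdsWithin] with τ hτ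
      rw [← lowPass_apply, map_sub, lowPass_apply, lowPass_apply, hu τ hτ, hu t ht]
    · simpa using (hc t ht).sub_const (u t)

end Norms

/-! ### Solutions of the filtered system are flow lines -/

section Solutions

variable {d n : ℕ} {A : Fin d → EuclideanSpace ℝ (Fin n) → Matrix (Fin n) (Fin n) ℝ}
  {p : Fin d → Fin n → Fin n → MvPolynomial (Fin n) ℝ} {s : ℝ} {N : ℕ} {U₀ : L2 d n} {I : Set ℝ}
  {U : ℝ → L2 d n}

/-- A curve whose initial value and velocity are low-pass stays low-pass. -/
theorem sharpFilter_eq_self_of_hasDerivAt (hI : IsOpen I) (hI' : I.OrdConnected)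
    (h0 : (0 : ℝ) ∈ I) (hU0 : sharpFilter N (U 0) = U 0) {V : ℝ → L2 d n}
    (hV : ∀ t ∈ I, sharpFilter N (V t) = V t) (hU : ∀ t ∈ I, HasDerivAt U (V t) t) :
    ∀ t ∈ I, sharpFilter N (U t) = U t := by
  have hd : ∀ t ∈ I, HasDerivAt (fun t => lowPass N (U t) - U t) 0 t := by
    intro t ht
    have := ((lowPass N).hasFDerivAt.comp_hasDerivAt t (hU t ht)).sub (hU t ht)
    rwa [lowPass_apply, hV t ht, sub_self] at this
  intro t ht
  have := hI.is_const_of_deriv_eq_zero hI'.isPreconnected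
    (fun t ht => (hd t ht).differentiableAt.differentiableWithinAt)
    (fun t ht => (hd t ht).deriv) ht h0
  simp only [lowPass_apply, hU0, sub_self] at this
  exact sub_eq_zero.1 this

theorem IsSolution.isFlowLine
    (hp : ∀ j a b u, A j u a b = MvPolynomial.eval (fun i => u i) (p j a b))
    (h : IsSolution A s N U₀ I U) : IsFlowLine (filteredField p N) (sharpFilter N U₀) I U := by
  refine ⟨h.isOpen, h.isInterval, h.zero_mem, h.initial, fun t ht => ?_⟩
  have hlow : ∀ t ∈ I, sharpFilter N (U t) = U t := by
    choose! W hW using h.equation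
    refine sharpFilter_eq_self_of_hasDerivAt h.isOpen h.isInterval h.zero_mem
      (by rw [h.initial, sharpFilter_sharpFilter]) (fun t ht => ?_) fun t ht => (hW t ht).2
    rw [← lowPass_apply, map_neg, lowPass_apply, sharpFilter_sharpFilter]
  obtain ⟨W, hW, hd⟩ := h.equation t ht
  -- The weak derivatives are determined by their Fourier coefficients.
  have hWeq : W = fun j => synth N fun k b =>
      Complex.I * (k j : ℂ) * fourierCoefficient (U t) k b := by
    funext j
    refine ext_fourierCoefficient fun k a => ?_
    rw [hW j, ((conjSymm_fourierCoefficient (U t)).partialDeriv j).fourierCoefficient_synth]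
    split_ifs with hk
    · rfl
    · rw [← hlow t ht, fourierCoefficient_sharpFilter, if_neg hk, mul_zero]
  rw [filteredField_eq hp, hlow t ht, ← hWeq]
  exact hd

theorem IsFlowLine.sharpFilter_eq
    (hp : ∀ j a b u, A j u a b = MvPolynomial.eval (fun i => u i) (p j a b))
    (h : IsFlowLine (filteredField p N) (sharpFilter N U₀) I U) :
    ∀ t ∈ I, sharpFilter N (U t) = U t := by
  refine sharpFilter_eq_self_of_hasDerivAt h.isOpen h.isInterval h.zero_mem
    (by rw [h.initial, sharpFilter_sharpFilter]) (fun t ht => ?_) h.hasDerivAt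
  rw [filteredField_eq hp, ← lowPass_apply, map_neg, lowPass_apply, sharpFilter_sharpFilter]

theorem IsFlowLine.isSolution
    (hp : ∀ j a b u, A j u a b = MvPolynomial.eval (fun i => u i) (p j a b)) (s : ℝ)
    (h : IsFlowLine (filteredField p N) (sharpFilter N U₀) I U) : IsSolution A s N U₀ I U := by
  have hlow := h.sharpFilter_eq hp
  refine ⟨h.isOpen, h.isInterval, h.zero_mem, continuousInHs_of_lowPass s hlow fun t ht =>
    (h.hasDerivAt t ht).continuousAt.continuousWithinAt, h.initial, fun t ht =>
    ⟨fun j => synth N fun k b => Complex.I * (k j : ℂ) * fourierCoefficient (U t) k b,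
      fun j k a => ?_, ?_⟩⟩
  · rw [((conjSymm_fourierCoefficient (U t)).partialDeriv j).fourierCoefficient_synth]
    split_ifs with hk
    · rfl
    · rw [← hlow t ht, fourierCoefficient_sharpFilter, if_neg hk, mul_zero]
  · have := h.hasDerivAt t ht
    rwa [filteredField_eq hp, hlow t ht] at this

end Solutions

/-! ### The Japanese bracket -/

section Bracket

variable {d : ℕ}

/-- The Japanese bracket `⟨k⟩ = (1 + |k|²)^{1/2}`. -/
def bracket (k : Fin d → ℤ) : ℝ := √(bracketSq k)

theorem one_le_bracket (k : Fin d → ℤ) : 1 ≤ bracket k := by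
  rw [bracket, Real.one_le_sqrt]
  exact one_le_bracketSq k

theorem bracket_pos (k : Fin d → ℤ) : 0 < bracket k := one_pos.trans_le (one_le_bracket k)

theorem bracket_rpow_sq (k : Fin d → ℤ) (σ : ℝ) : (bracket k ^ σ) ^ 2 = bracketSq k ^ σ := by
  rw [bracket, Real.sqrt_eq_rpow, ← Real.rpow_mul (bracketSq_pos k).le, ← Real.rpow_natCast,
    ← Real.rpow_mul (bracketSq_pos k).le]
  congr 1
  push_cast
  ring

theorem bracketSq_neg (k : Fin d → ℤ) : bracketSq (-k) = bracketSq k := by simp [bracketSq]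

theorem bracket_neg (k : Fin d → ℤ) : bracket (-k) = bracket k := by
  rw [bracket, bracketSq_neg, bracket]

theorem bracketSq_eq (k : Fin d → ℤ) :
    bracketSq k = 1 + ‖(WithLp.toLp 2 fun j => (k j : ℝ) : EuclideanSpace ℝ (Fin d))‖ ^ 2 := by
  simp [bracketSq, EuclideanSpace.norm_sq_eq]

theorem abs_le_bracket (k : Fin d → ℤ) (j : Fin d) : |(k j : ℝ)| ≤ bracket k := by
  rw [bracket, ← Real.sqrt_sq_eq_abs]
  refine Real.sqrt_le_sqrt ?_
  have := Finset.single_le_sum (f := fun j => (k j : ℝ) ^ 2) (fun i _ => sq_nonneg _)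
    (Finset.mem_univ j)
  unfold bracketSq
  linarith

theorem bracket_le_add (k m : Fin d → ℤ) : bracket k ≤ bracket m + bracket (k - m) := by
  have hle : ∀ l : Fin d → ℤ,
      ‖(WithLp.toLp 2 fun j => (l j : ℝ) : EuclideanSpace ℝ (Fin d))‖ ≤ bracket l := fun l => by
    rw [bracket, bracketSq_eq]
    exact Real.le_sqrt_of_sq_le (by linarith)
  have hsq : ∀ l : Fin d → ℤ, bracket l ^ 2 =
      1 + ‖(WithLp.toLp 2 fun j => (l j : ℝ) : EuclideanSpace ℝ (Fin d))‖ ^ 2 := fun l => by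
    rw [bracket, Real.sq_sqrt (bracketSq_pos l).le, bracketSq_eq]
  have htri := norm_add_le (WithLp.toLp 2 fun j => (m j : ℝ) : EuclideanSpace ℝ (Fin d))
    (WithLp.toLp 2 fun j => ((k - m) j : ℝ))
  have heq : (WithLp.toLp 2 fun j => (m j : ℝ) : EuclideanSpace ℝ (Fin d)) +
      (WithLp.toLp 2 fun j => ((k - m) j : ℝ)) = WithLp.toLp 2 fun j => (k j : ℝ) := by
    ext j; simp
  rw [heq] at htri
  refine abs_le_of_sq_le_sq' ?_ (add_pos (bracket_pos m) (bracket_pos _)).le |>.2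
  have h1 := hsq k
  have h2 := hsq m
  have h3 := hsq (k - m)
  have h4 := mul_le_mul (hle m) (hle (k - m)) (norm_nonneg _) (bracket_pos m).le
  have h5 := mul_self_le_mul_self (norm_nonneg _) htri
  nlinarith

theorem bracket_le_mul (k m : Fin d → ℤ) : bracket k ≤ 2 * (bracket (k - m) * bracket m) := by
  have := bracket_le_add k m
  nlinarith [one_le_bracket m, one_le_bracket (k - m)]

theorem bracket_rpow_le (k m : Fin d → ℤ) {σ : ℝ} (hσ : 0 ≤ σ) :
    bracket k ^ σ ≤ 2 ^ σ * (bracket (k - m) ^ σ + bracket m ^ σ) := by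
  have h := bracket_le_add k m
  have h1 := Real.rpow_nonneg (bracket_pos m).le σ
  have h2 := Real.rpow_nonneg (bracket_pos (k - m)).le σ
  have h3 : (0 : ℝ) ≤ 2 ^ σ := by positivity
  rcases le_total (bracket (k - m)) (bracket m) with h' | h'
  · calc bracket k ^ σ ≤ (2 * bracket m) ^ σ :=
          Real.rpow_le_rpow (bracket_pos k).le (by linarith) hσ
      _ = 2 ^ σ * bracket m ^ σ := Real.mul_rpow (by norm_num) (bracket_pos m).le
      _ ≤ _ := mul_le_mul_of_nonneg_left (by linarith) h3
  · calc bracket k ^ σ ≤ (2 * bracket (k - m)) ^ σ :=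
          Real.rpow_le_rpow (bracket_pos k).le (by linarith) hσ
      _ = 2 ^ σ * bracket (k - m) ^ σ := Real.mul_rpow (by norm_num) (bracket_pos _).le
      _ ≤ _ := mul_le_mul_of_nonneg_left (by linarith) h3

/-- The lattice sum `∑_k ⟨k⟩^{-2σ}` converges for `σ > d/2`. -/
theorem exists_sum_bracketSq_rpow_le {σ : ℝ} (hσ : (d : ℝ) / 2 < σ) :
    ∃ K : ℝ, 0 ≤ K ∧ ∀ S : Finset (Fin d → ℤ), ∑ k ∈ S, bracketSq k ^ (-σ) ≤ K := by
  classical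
  -- Compare with the sum of `‖k‖^{-2σ}` over the lattice `ℤ^d` with the sup norm; `0 ^ (-2σ)`
  -- is `0` there, hence the separate treatment of `k = 0`.
  let b := Pi.basisFun ℝ (Fin d)
  let L := Submodule.span ℤ (Set.range b)
  have hfin : Module.finrank ℤ L = d := by
    rw [ZLattice.rank ℝ L]; simp
  have hsum : Summable fun z : L => ‖z‖ ^ (-(2 * σ)) :=
    ZLattice.summable_norm_rpow L _ (by rw [hfin]; linarith)
  let φ : (Fin d → ℤ) → L := fun k => ∑ i, k i • ⟨b i, Submodule.subset_span ⟨i, rfl⟩⟩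
  have hφ : ∀ k i, (φ k : Fin d → ℝ) i = k i := fun k i => by
    simp [φ, b, Finset.sum_apply, Pi.single_apply]
  have hinj : Function.Injective φ := fun k m h => by
    ext i
    have := hφ m i
    rw [← h, hφ] at this
    exact_mod_cast this
  have hs := hsum.comp_injective hinj
  have hterm : ∀ k : Fin d → ℤ, k ≠ 0 → bracketSq k ^ (-σ) ≤ ‖φ k‖ ^ (-(2 * σ)) := by
    intro k hk
    have h0 : φ 0 = 0 := by
      ext i
      rw [hφ]
      simp
    have hpos : 0 < ‖φ k‖ := norm_pos_iff.2 fun h => hk <| hinj <| h.trans h0.symm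
    have h1 : ‖φ k‖ ≤ bracket k := by
      refine (pi_norm_le_iff_of_nonneg (bracket_pos k).le).2 fun i => ?_
      change ‖(φ k : Fin d → ℝ) i‖ ≤ bracket k
      rw [hφ, Real.norm_eq_abs]
      exact abs_le_bracket k i
    have h2 : ‖φ k‖ ^ 2 ≤ bracketSq k := by
      have := pow_le_pow_left₀ hpos.le h1 2
      rwa [bracket, Real.sq_sqrt (bracketSq_pos k).le] at this
    have h0 : (0 : ℝ) ≤ d := by positivity
    calc bracketSq k ^ (-σ) ≤ (‖φ k‖ ^ 2) ^ (-σ) :=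
          Real.rpow_le_rpow_of_nonpos (by positivity) h2 (by linarith)
      _ = ‖φ k‖ ^ (-(2 * σ)) := by
          rw [← Real.rpow_natCast, ← Real.rpow_mul hpos.le]; congr 1; push_cast; ring
  have hnn : ∀ k, 0 ≤ ‖φ k‖ ^ (-(2 * σ)) := fun k => by positivity
  refine ⟨1 + ∑' k, ‖φ k‖ ^ (-(2 * σ)), add_nonneg one_pos.le (tsum_nonneg hnn), fun S => ?_⟩
  calc ∑ k ∈ S, bracketSq k ^ (-σ)
      ≤ ∑ k ∈ S, ((if k = 0 then 1 else 0) + ‖φ k‖ ^ (-(2 * σ))) := by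
        refine Finset.sum_le_sum fun k _ => ?_
        split_ifs with hk
        · have h0 : bracketSq k = 1 := by simp [hk, bracketSq]
          rw [h0, Real.one_rpow]
          linarith [hnn k]
        · rw [zero_add]
          exact hterm k hk
    _ ≤ _ := by
        rw [Finset.sum_add_distrib]
        refine add_le_add ?_ (hs.sum_le_tsum S fun k _ => hnn k)
        rw [Finset.sum_ite_eq']
        split_ifs <;> norm_num

end Bracket

/-! ### The commutator kernel -/

section Kernel

/-- A mean value bound for powers, from Bernoulli's inequality for `q / p`. -/
theorem rpow_sub_rpow_le {p q a : ℝ} (hq : 0 < q) (hqp : q ≤ p) (ha : 1 ≤ a) :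
    p ^ a - q ^ a ≤ a * p ^ (a - 1) * (p - q) := by
  have hp : 0 < p := hq.trans_le hqp
  have h := one_add_mul_self_le_rpow_one_add (s := q / p - 1)
    (by linarith [div_pos hq hp]) ha
  rw [add_sub_cancel, Real.div_rpow hq.le hp.le, le_div_iff₀ (by positivity)] at h
  have h2 : p ^ a = p ^ (a - 1) * p := by
    rw [← Real.rpow_add_one hp.ne']; congr 1; ring
  have h3 : (1 + a * (q / p - 1)) * p ^ a = p ^ a - a * p ^ (a - 1) * (p - q) := by
    rw [h2]; field_simp; ring
  linarith

/-- The commutator kernel: the cancellation in `p^{2σ} x - q^{2σ} y` for `x` close to `y` and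
`p` close to `q` gains one power. -/
theorem abs_kernel_le_of_le {σ p q r x y : ℝ} (hσ : 1 ≤ σ) (hq : 1 ≤ q) (hr : 1 ≤ r)
    (hqp : q ≤ p) (hpqr : p ≤ q + r) (hx : |x| ≤ q) (hy : |y| ≤ p) (hxy : |x - y| ≤ r) :
    |(p ^ σ) ^ 2 * x - (q ^ σ) ^ 2 * y| ≤ (2 * σ * 2 ^ σ + 1 + 2 * 2 ^ σ) *
      (r * (p ^ σ * q ^ σ) + p ^ σ * (r ^ σ * q) + q ^ σ * (r ^ σ * p)) := by
  have hq0 : 0 < q := by linarith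
  have hp0 : 0 < p := by linarith
  have hr0 : 0 < r := by linarith
  have hpp : (p ^ σ) ^ 2 = p ^ (2 * σ) := by
    rw [← Real.rpow_natCast, ← Real.rpow_mul hp0.le]; congr 1; push_cast; ring
  have hqq : (q ^ σ) ^ 2 = q ^ (2 * σ) := by
    rw [← Real.rpow_natCast, ← Real.rpow_mul hq0.le]; congr 1; push_cast; ring
  have hP : 0 < p ^ σ := by positivity
  have hQ : 0 < q ^ σ := by positivity
  have hR : 0 < r ^ σ := by positivity
  have h2 : (0 : ℝ) < 2 ^ σ := by positivity
  have hQP : q ^ σ ≤ p ^ σ := Real.rpow_le_rpow hq0.le hqp (by linarith)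
  have t2 : 0 ≤ p ^ σ * (r ^ σ * q) := by positivity
  have t3 : 0 ≤ q ^ σ * (r ^ σ * p) := by positivity
  have t1 : 0 ≤ r * (p ^ σ * q ^ σ) := by positivity
  -- For `r ≤ q` the sizes `p` and `q` are comparable and the difference is a commutator; for
  -- `q ≤ r` the weight `p ^ σ` can be transferred to `r`, and no cancellation is needed.
  rcases le_total r q with hrq | hrq
  · have hPQ : p ^ σ ≤ 2 ^ σ * q ^ σ := by
      rw [← Real.mul_rpow (by norm_num) hq0.le]
      exact Real.rpow_le_rpow hp0.le (by linarith) (by linarith)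
    have hd0 : 0 ≤ (p ^ σ) ^ 2 - (q ^ σ) ^ 2 := by nlinarith
    have hd : ((p ^ σ) ^ 2 - (q ^ σ) ^ 2) * q ≤ 2 * σ * r * (p ^ σ) ^ 2 := by
      have h := rpow_sub_rpow_le hq0 hqp (a := 2 * σ) (by linarith)
      have h1 : p ^ (2 * σ - 1) * p = p ^ (2 * σ) := by
        rw [← Real.rpow_add_one hp0.ne']; congr 1; ring
      rw [hpp, hqq]
      have hA : 0 < p ^ (2 * σ - 1) := by positivity
      have h3 : 0 < σ := by linarith
      calc (p ^ (2 * σ) - q ^ (2 * σ)) * q ≤ (2 * σ * p ^ (2 * σ - 1) * (p - q)) * q := by gcongr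
        _ ≤ (2 * σ * p ^ (2 * σ - 1) * r) * p := by gcongr; linarith
        _ = 2 * σ * r * p ^ (2 * σ) := by rw [← h1]; ring
    calc |(p ^ σ) ^ 2 * x - (q ^ σ) ^ 2 * y|
        = |((p ^ σ) ^ 2 - (q ^ σ) ^ 2) * x + (q ^ σ) ^ 2 * (x - y)| := by congr 1; ring
      _ ≤ |((p ^ σ) ^ 2 - (q ^ σ) ^ 2) * x| + |(q ^ σ) ^ 2 * (x - y)| := abs_add_le _ _
      _ = ((p ^ σ) ^ 2 - (q ^ σ) ^ 2) * |x| + (q ^ σ) ^ 2 * |x - y| := by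
          rw [abs_mul, abs_mul, abs_of_nonneg hd0, abs_of_nonneg (sq_nonneg (q ^ σ))]
      _ ≤ ((p ^ σ) ^ 2 - (q ^ σ) ^ 2) * q + (q ^ σ) ^ 2 * r := by gcongr
      _ ≤ 2 * σ * r * (p ^ σ) ^ 2 + (q ^ σ) ^ 2 * r := by linarith
      _ ≤ 2 * σ * r * (p ^ σ * (2 ^ σ * q ^ σ)) + (p ^ σ * q ^ σ) * r := by
          rw [sq (p ^ σ), sq (q ^ σ)]
          gcongr
      _ = (2 * σ * 2 ^ σ + 1) * (r * (p ^ σ * q ^ σ)) := by ring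
      _ ≤ _ := mul_le_mul (by linarith) (by linarith) t1 (by nlinarith)
  · have hPR : p ^ σ ≤ 2 ^ σ * r ^ σ := by
      rw [← Real.mul_rpow (by norm_num) hr0.le]
      exact Real.rpow_le_rpow hp0.le (by linarith) (by linarith)
    have hlast : (q ^ σ) ^ 2 * p ≤ (p ^ σ) ^ 2 * q := by
      have h1 : p ^ (2 * σ - 1) * p = p ^ (2 * σ) := by
        rw [← Real.rpow_add_one hp0.ne']; congr 1; ring
      have h1' : q ^ (2 * σ - 1) * q = q ^ (2 * σ) := by
        rw [← Real.rpow_add_one hq0.ne']; congr 1; ring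
      have h3 : q ^ (2 * σ - 1) ≤ p ^ (2 * σ - 1) :=
        Real.rpow_le_rpow hq0.le hqp (by linarith)
      rw [hpp, hqq, ← h1, ← h1']
      have := mul_le_mul_of_nonneg_right h3 (mul_pos hp0 hq0).le
      nlinarith
    calc |(p ^ σ) ^ 2 * x - (q ^ σ) ^ 2 * y|
        ≤ |(p ^ σ) ^ 2 * x| + |(q ^ σ) ^ 2 * y| := abs_sub _ _
      _ = (p ^ σ) ^ 2 * |x| + (q ^ σ) ^ 2 * |y| := by
          rw [abs_mul, abs_mul, abs_of_nonneg (sq_nonneg (p ^ σ)),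
            abs_of_nonneg (sq_nonneg (q ^ σ))]
      _ ≤ (p ^ σ) ^ 2 * q + (q ^ σ) ^ 2 * p := by gcongr
      _ ≤ 2 * ((p ^ σ) ^ 2 * q) := by linarith
      _ ≤ 2 * ((p ^ σ * (2 ^ σ * r ^ σ)) * q) := by rw [sq]; gcongr
      _ = (2 * 2 ^ σ) * (p ^ σ * (r ^ σ * q)) := by ring
      _ ≤ _ := by
          have h3 : 0 < σ * 2 ^ σ := mul_pos (by linarith) h2
          exact mul_le_mul (by linarith) (by linarith) t2 (by linarith)

theorem abs_kernel_le {σ p q r x y : ℝ} (hσ : 1 ≤ σ) (hp : 1 ≤ p) (hq : 1 ≤ q) (hr : 1 ≤ r)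
    (hpqr : p ≤ q + r) (hqpr : q ≤ p + r) (hx : |x| ≤ q) (hy : |y| ≤ p) (hxy : |x - y| ≤ r) :
    |(p ^ σ) ^ 2 * x - (q ^ σ) ^ 2 * y| ≤ (2 * σ * 2 ^ σ + 1 + 2 * 2 ^ σ) *
      (r * (p ^ σ * q ^ σ) + p ^ σ * (r ^ σ * q) + q ^ σ * (r ^ σ * p)) := by
  rcases le_total q p with h | h
  · exact abs_kernel_le_of_le hσ hq hr h hpqr hx hy hxy
  · rw [abs_sub_comm]
    refine (abs_kernel_le_of_le hσ hp hr h hqpr hy hx (by rwa [abs_sub_comm])).trans_eq ?_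
    ring

end Kernel

/-! ### Young's inequality for convolutions -/

section Young

variable {G : Type*} [AddCommGroup G]

theorem sum_shift_le {φ : G → ℝ} {B : ℝ} (h : ∀ S : Finset G, ∑ k ∈ S, φ k ≤ B) (S : Finset G)
    (m : G) : ∑ k ∈ S, φ (k - m) ≤ B := by
  simpa using h (S.map (Equiv.subRight m).toEmbedding)

theorem sum_reflect_le {φ : G → ℝ} {B : ℝ} (h : ∀ S : Finset G, ∑ k ∈ S, φ k ≤ B) (S : Finset G)
    (m : G) : ∑ k ∈ S, φ (m - k) ≤ B := by
  simpa using h (S.map (Equiv.subLeft m).toEmbedding)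

variable {a b : G → ℝ} {A B : ℝ}

/-- Young's inequality `ℓ² * ℓ¹ ⊆ ℓ²`. -/
theorem sum_conv_sq_le (hb : ∀ k, 0 ≤ b k) (hA : ∀ S : Finset G, ∑ k ∈ S, a k ^ 2 ≤ A)
    (hB : ∀ S : Finset G, ∑ k ∈ S, b k ≤ B) (S T : Finset G) :
    ∑ k ∈ S, (∑ m ∈ T, a (k - m) * b m) ^ 2 ≤ B ^ 2 * A := by
  have hB0 : 0 ≤ B := by simpa using hB ∅
  have hA0 : 0 ≤ A := by simpa using hA ∅
  calc ∑ k ∈ S, (∑ m ∈ T, a (k - m) * b m) ^ 2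
      ≤ ∑ k ∈ S, B * ∑ m ∈ T, a (k - m) ^ 2 * b m := by
        refine Finset.sum_le_sum fun k _ => ?_
        refine (Finset.sum_sq_le_sum_mul_sum_of_sq_le_mul T (f := b)
          (g := fun m => a (k - m) ^ 2 * b m) (fun m _ => hb m)
          (fun m _ => mul_nonneg (sq_nonneg _) (hb m)) fun m _ => by
            apply le_of_eq; ring).trans ?_
        exact mul_le_mul_of_nonneg_right (hB T)
          (Finset.sum_nonneg fun m _ => mul_nonneg (sq_nonneg _) (hb m))
    _ = B * ∑ m ∈ T, (∑ k ∈ S, a (k - m) ^ 2) * b m := by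
        rw [← Finset.mul_sum, Finset.sum_comm]
        simp only [Finset.sum_mul]
    _ ≤ B * ∑ m ∈ T, A * b m := by
        gcongr with m _
        · exact hb m
        · exact sum_shift_le (φ := fun k => a k ^ 2) hA S m
    _ = B * (A * ∑ m ∈ T, b m) := by rw [← Finset.mul_sum]
    _ ≤ B * (A * B) := by gcongr; exact hB T
    _ = B ^ 2 * A := by ring

/-- Young's inequality `ℓ¹ * ℓ² ⊆ ℓ²`. -/
theorem sum_conv_sq_le' (hb : ∀ k, 0 ≤ b k) (hA : ∀ S : Finset G, ∑ k ∈ S, a k ^ 2 ≤ A)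
    (hB : ∀ S : Finset G, ∑ k ∈ S, b k ≤ B) (S T : Finset G) :
    ∑ k ∈ S, (∑ m ∈ T, b (k - m) * a m) ^ 2 ≤ B ^ 2 * A := by
  have hB0 : 0 ≤ B := by simpa using hB ∅
  calc ∑ k ∈ S, (∑ m ∈ T, b (k - m) * a m) ^ 2
      ≤ ∑ k ∈ S, B * ∑ m ∈ T, b (k - m) * a m ^ 2 := by
        refine Finset.sum_le_sum fun k _ => ?_
        refine (Finset.sum_sq_le_sum_mul_sum_of_sq_le_mul T (f := fun m => b (k - m))
          (g := fun m => b (k - m) * a m ^ 2) (fun m _ => hb _)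
          (fun m _ => mul_nonneg (hb _) (sq_nonneg _)) fun m _ => by
            apply le_of_eq; ring).trans ?_
        exact mul_le_mul_of_nonneg_right (sum_reflect_le hB T k)
          (Finset.sum_nonneg fun m _ => mul_nonneg (hb _) (sq_nonneg _))
    _ = B * ∑ m ∈ T, (∑ k ∈ S, b (k - m)) * a m ^ 2 := by
        rw [← Finset.mul_sum, Finset.sum_comm]
        simp only [Finset.sum_mul]
    _ ≤ B * ∑ m ∈ T, B * a m ^ 2 := by
        gcongr with m _
        exact sum_shift_le hB S m
    _ = B * (B * ∑ m ∈ T, a m ^ 2) := by rw [← Finset.mul_sum]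
    _ ≤ B * (B * A) := by gcongr; exact hA T
    _ = B ^ 2 * A := by ring

variable {D : ℝ}

/-- Cauchy-Schwarz for a trilinear sum, given Young's inequality for the inner convolution. -/
theorem sum_sum_le_of_sum_conv_sq_le {c : G → ℝ} (hc : ∀ S : Finset G, ∑ k ∈ S, c k ^ 2 ≤ D)
    (hB : 0 ≤ B) {T : Finset G}
    (h : ∀ S : Finset G, ∑ k ∈ S, (∑ m ∈ T, b (k - m) * a m) ^ 2 ≤ B ^ 2 * A) (S : Finset G) :
    ∑ k ∈ S, ∑ m ∈ T, c k * (b (k - m) * a m) ≤ B * (√D * √A) := by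
  calc ∑ k ∈ S, ∑ m ∈ T, c k * (b (k - m) * a m)
      = ∑ k ∈ S, c k * ∑ m ∈ T, b (k - m) * a m := by simp only [Finset.mul_sum]
    _ ≤ √(∑ k ∈ S, c k ^ 2) * √(∑ k ∈ S, (∑ m ∈ T, b (k - m) * a m) ^ 2) :=
        Real.sum_mul_le_sqrt_mul_sqrt _ _ _
    _ ≤ √D * √(B ^ 2 * A) := by
        gcongr
        · exact hc S
        · exact h S
    _ = B * (√D * √A) := by
        rw [Real.sqrt_mul (sq_nonneg _), Real.sqrt_sq hB]; ring

end Young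

/-! ### The Wiener algebra and tame estimates for products and polynomials -/

section SequenceNorms

variable {d n : ℕ} {f g : TrigPoly d} {X Y B B' σ : ℝ}

/-- `∑_k ⟨k⟩ |f_k| ≤ X`: a bound in the Wiener algebra with one derivative. -/
def WienerLE (f : TrigPoly d) (X : ℝ) : Prop :=
  ∀ S : Finset (Fin d → ℤ), ∑ k ∈ S, bracket k * ‖f.coeff k‖ ≤ X

/-- `∑_k ⟨k⟩^{2σ} |f_k|² ≤ B`: a bound on the square of the `H^σ` norm. -/
def SobolevLE (σ : ℝ) (f : TrigPoly d) (B : ℝ) : Prop :=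
  ∀ S : Finset (Fin d → ℤ), ∑ k ∈ S, (bracket k ^ σ * ‖f.coeff k‖) ^ 2 ≤ B

theorem WienerLE.nonneg (h : WienerLE f X) : 0 ≤ X := by simpa using h ∅

theorem SobolevLE.nonneg (h : SobolevLE σ f B) : 0 ≤ B := by simpa using h ∅

theorem WienerLE.mono (h : WienerLE f X) (hXY : X ≤ Y) : WienerLE f Y :=
  fun S => (h S).trans hXY

theorem SobolevLE.mono (h : SobolevLE σ f B) (hB : B ≤ B') : SobolevLE σ f B' :=
  fun S => (h S).trans hB

theorem WienerLE.sum_norm_le (h : WienerLE f X) (S : Finset (Fin d → ℤ)) :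
    ∑ k ∈ S, ‖f.coeff k‖ ≤ X :=
  (Finset.sum_le_sum fun k _ => le_mul_of_one_le_left (norm_nonneg _) (one_le_bracket k)).trans
    (h S)

theorem wienerLE_zero : WienerLE (0 : TrigPoly d) 0 := fun S => by simp

theorem sobolevLE_zero : SobolevLE σ (0 : TrigPoly d) 0 := fun S => by simp

theorem WienerLE.add (hf : WienerLE f X) (hg : WienerLE g Y) : WienerLE (f + g) (X + Y) := by
  intro S
  refine (Finset.sum_le_sum fun k _ => ?_).trans
    ((Finset.sum_add_distrib).trans_le (add_le_add (hf S) (hg S)))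
  rw [← mul_add, AddMonoidAlgebra.coeff_add, Finsupp.add_apply]
  exact mul_le_mul_of_nonneg_left (norm_add_le _ _) (bracket_pos k).le

theorem SobolevLE.add (hf : SobolevLE σ f B) (hg : SobolevLE σ g B') :
    SobolevLE σ (f + g) (2 * B + 2 * B') := by
  intro S
  calc ∑ k ∈ S, (bracket k ^ σ * ‖(f + g).coeff k‖) ^ 2
      ≤ ∑ k ∈ S, (2 * (bracket k ^ σ * ‖f.coeff k‖) ^ 2 +
          2 * (bracket k ^ σ * ‖g.coeff k‖) ^ 2) := by
        refine Finset.sum_le_sum fun k _ => ?_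
        have h1 : bracket k ^ σ * ‖(f + g).coeff k‖ ≤
            bracket k ^ σ * ‖f.coeff k‖ + bracket k ^ σ * ‖g.coeff k‖ := by
          rw [← mul_add, AddMonoidAlgebra.coeff_add, Finsupp.add_apply]
          exact mul_le_mul_of_nonneg_left (norm_add_le _ _)
            (Real.rpow_nonneg (bracket_pos k).le _)
        have h0 : 0 ≤ bracket k ^ σ * ‖(f + g).coeff k‖ :=
          mul_nonneg (Real.rpow_nonneg (bracket_pos k).le _) (norm_nonneg _)
        nlinarith [sq_nonneg (bracket k ^ σ * ‖f.coeff k‖ - bracket k ^ σ * ‖g.coeff k‖),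
          mul_self_le_mul_self h0 h1]
    _ = 2 * ∑ k ∈ S, (bracket k ^ σ * ‖f.coeff k‖) ^ 2 +
          2 * ∑ k ∈ S, (bracket k ^ σ * ‖g.coeff k‖) ^ 2 := by
        rw [Finset.sum_add_distrib, Finset.mul_sum, Finset.mul_sum]
    _ ≤ 2 * B + 2 * B' := by
        have := hf S
        have := hg S
        linarith

theorem WienerLE.smul (hf : WienerLE f X) (r : ℝ) : WienerLE (r • f) (|r| * X) := by
  intro S
  refine le_trans (le_of_eq ?_) (mul_le_mul_of_nonneg_left (hf S) (abs_nonneg r))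
  rw [Finset.mul_sum]
  refine Finset.sum_congr rfl fun k _ => ?_
  rw [AddMonoidAlgebra.coeff_smul, Finsupp.smul_apply, norm_smul, Real.norm_eq_abs]
  ring

theorem SobolevLE.smul (hf : SobolevLE σ f B) (r : ℝ) : SobolevLE σ (r • f) (r ^ 2 * B) := by
  intro S
  refine le_trans (le_of_eq ?_) (mul_le_mul_of_nonneg_left (hf S) (sq_nonneg r))
  rw [Finset.mul_sum]
  refine Finset.sum_congr rfl fun k _ => ?_
  rw [AddMonoidAlgebra.coeff_smul, Finsupp.smul_apply, norm_smul, Real.norm_eq_abs, ← sq_abs r]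
  ring

theorem norm_coeff_mul_le (f g : TrigPoly d) (k : Fin d → ℤ) :
    ‖(f * g).coeff k‖ ≤ ∑ m ∈ g.coeff.support, ‖f.coeff (k - m)‖ * ‖g.coeff m‖ := by
  rw [coeff_mul_of_support f g (S := g.coeff.support)
    (fun k hk => Finsupp.notMem_support_iff.1 hk) k]
  refine (norm_sum_le _ _).trans_eq ?_
  simp only [norm_mul]

theorem WienerLE.mul (hf : WienerLE f X) (hg : WienerLE g Y) : WienerLE (f * g) (2 * X * Y) := by
  intro S
  calc ∑ k ∈ S, bracket k * ‖(f * g).coeff k‖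
      ≤ ∑ k ∈ S, ∑ m ∈ g.coeff.support,
          2 * ((bracket (k - m) * ‖f.coeff (k - m)‖) * (bracket m * ‖g.coeff m‖)) := by
        refine Finset.sum_le_sum fun k _ => ?_
        refine (mul_le_mul_of_nonneg_left (norm_coeff_mul_le f g k) (bracket_pos k).le).trans ?_
        rw [Finset.mul_sum]
        refine Finset.sum_le_sum fun m _ => ?_
        refine (mul_le_mul_of_nonneg_right (bracket_le_mul k m) (by positivity)).trans_eq ?_
        ring
    _ = 2 * ∑ m ∈ g.coeff.support, (∑ k ∈ S, bracket (k - m) * ‖f.coeff (k - m)‖) *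
          (bracket m * ‖g.coeff m‖) := by
        rw [Finset.sum_comm]
        simp only [Finset.mul_sum, Finset.sum_mul]
    _ ≤ 2 * ∑ m ∈ g.coeff.support, X * (bracket m * ‖g.coeff m‖) := by
        gcongr with m _
        · exact mul_nonneg (bracket_pos m).le (norm_nonneg _)
        · exact sum_shift_le (φ := fun k => bracket k * ‖f.coeff k‖) hf S m
    _ = 2 * X * ∑ m ∈ g.coeff.support, bracket m * ‖g.coeff m‖ := by
        rw [← Finset.mul_sum, mul_assoc]
    _ ≤ 2 * X * Y := mul_le_mul_of_nonneg_left (hg _) (by linarith [hf.nonneg])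

/-- The tame product estimate in `H^σ`. -/
theorem SobolevLE.mul (hσ : 0 ≤ σ) (hfX : WienerLE f X) (hfB : SobolevLE σ f B)
    (hgY : WienerLE g Y) (hgB : SobolevLE σ g B') :
    SobolevLE σ (f * g) (2 * (2 ^ σ) ^ 2 * (Y ^ 2 * B + X ^ 2 * B')) := by
  intro S
  have hw : ∀ k : Fin d → ℤ, 0 ≤ bracket k ^ σ := fun k => Real.rpow_nonneg (bracket_pos k).le _
  have h2 : (0 : ℝ) ≤ 2 ^ σ := by positivity
  have h1 := sum_conv_sq_le (a := fun k => bracket k ^ σ * ‖f.coeff k‖)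
    (b := fun k => ‖g.coeff k‖) (fun k => norm_nonneg _) hfB hgY.sum_norm_le S g.coeff.support
  have h3 := sum_conv_sq_le' (a := fun k => bracket k ^ σ * ‖g.coeff k‖)
    (b := fun k => ‖f.coeff k‖) (fun k => norm_nonneg _) hgB hfX.sum_norm_le S g.coeff.support
  set P : (Fin d → ℤ) → ℝ := fun k => ∑ m ∈ g.coeff.support,
    bracket (k - m) ^ σ * ‖f.coeff (k - m)‖ * ‖g.coeff m‖ with hP
  set Q : (Fin d → ℤ) → ℝ := fun k => ∑ m ∈ g.coeff.support,
    ‖f.coeff (k - m)‖ * (bracket m ^ σ * ‖g.coeff m‖) with hQ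
  have hpt : ∀ k, bracket k ^ σ * ‖(f * g).coeff k‖ ≤ 2 ^ σ * (P k + Q k) := by
    intro k
    refine (mul_le_mul_of_nonneg_left (norm_coeff_mul_le f g k) (hw k)).trans ?_
    rw [hP, hQ, ← Finset.sum_add_distrib, Finset.mul_sum, Finset.mul_sum]
    refine Finset.sum_le_sum fun m _ => ?_
    refine (mul_le_mul_of_nonneg_right (bracket_rpow_le k m hσ) (by positivity)).trans_eq ?_
    ring
  calc ∑ k ∈ S, (bracket k ^ σ * ‖(f * g).coeff k‖) ^ 2
      ≤ ∑ k ∈ S, (2 * (2 ^ σ) ^ 2 * P k ^ 2 + 2 * (2 ^ σ) ^ 2 * Q k ^ 2) := by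
        refine Finset.sum_le_sum fun k _ => ?_
        have h0 : 0 ≤ bracket k ^ σ * ‖(f * g).coeff k‖ := mul_nonneg (hw k) (norm_nonneg _)
        have := pow_le_pow_left₀ h0 (hpt k) 2
        have h4 : 0 ≤ (2 ^ σ) ^ 2 * (P k - Q k) ^ 2 := by positivity
        nlinarith
    _ = 2 * (2 ^ σ) ^ 2 * (∑ k ∈ S, P k ^ 2 + ∑ k ∈ S, Q k ^ 2) := by
        rw [Finset.sum_add_distrib, ← Finset.mul_sum, ← Finset.mul_sum, mul_add]
    _ ≤ _ := by gcongr

/-- Composition with a polynomial `q`: linear bounds for `q(y) - q(0)` in the Wiener algebra and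
in `H^σ`, with a constant that depends only on `q`, `σ` and the bound `M` in the Wiener algebra. -/
theorem exists_aeval_sub_le (hσ : 0 ≤ σ) (M : ℝ) (q : MvPolynomial (Fin n) ℝ) :
    ∃ C : ℝ, 0 ≤ C ∧ ∀ (y : Fin n → TrigPoly d) (X B : ℝ), X ≤ M → (∀ a, WienerLE (y a) X) →
      0 ≤ X → 0 ≤ B → (∀ a, SobolevLE σ (y a) B) →
      WienerLE (MvPolynomial.aeval y q - algebraMap ℝ _ (MvPolynomial.constantCoeff q)) (C * X) ∧
      SobolevLE σ (MvPolynomial.aeval y q - algebraMap ℝ _ (MvPolynomial.constantCoeff q))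
        (C * B) := by
  induction q using MvPolynomial.induction_on with
  | C r =>
    refine ⟨0, le_rfl, fun y X B _ _ _ _ _ => ?_⟩
    simp only [MvPolynomial.aeval_C, MvPolynomial.constantCoeff_C, sub_self, zero_mul]
    exact ⟨wienerLE_zero, sobolevLE_zero⟩
  | add q r hq hr =>
    obtain ⟨C, hC, h1⟩ := hq
    obtain ⟨C', hC', h2⟩ := hr
    refine ⟨2 * C + 2 * C', by positivity, fun y X B hXM hX hX0 hB0 hB => ?_⟩
    obtain ⟨hq1, hq2⟩ := h1 y X B hXM hX hX0 hB0 hB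
    obtain ⟨hr1, hr2⟩ := h2 y X B hXM hX hX0 hB0 hB
    rw [map_add, map_add, map_add, add_sub_add_comm]
    refine ⟨(hq1.add hr1).mono ?_, (hq2.add hr2).mono ?_⟩
    · nlinarith [mul_nonneg hC hX0, mul_nonneg hC' hX0]
    · nlinarith [mul_nonneg hC hB0, mul_nonneg hC' hB0]
  | mul_X q i hq =>
    obtain ⟨C, hC, h1⟩ := hq
    set r := MvPolynomial.constantCoeff q with hr
    have h2 : (0 : ℝ) < (2 ^ σ) ^ 2 := by positivity
    refine ⟨2 * C * |M| + |r| + (2 * (2 * (2 ^ σ) ^ 2 * (M ^ 2 * C + (C * M) ^ 2)) + 2 * r ^ 2),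
      by positivity, fun y X B hXM hX hX0 hB0 hB => ?_⟩
    obtain ⟨hq1, hq2⟩ := h1 y X B hXM hX hX0 hB0 hB
    have hXX : X ^ 2 ≤ M ^ 2 := pow_le_pow_left₀ hX0 hXM 2
    -- `q X_i - 0 = (q - q(0)) X_i + q(0) X_i`, with one factor bounded by `M` in the first product.
    have heq : MvPolynomial.aeval y (q * MvPolynomial.X i) -
        algebraMap ℝ (TrigPoly d) (MvPolynomial.constantCoeff (q * MvPolynomial.X i)) =
        (MvPolynomial.aeval y q - algebraMap ℝ (TrigPoly d) r) * y i + r • y i := by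
      rw [map_mul, map_mul, MvPolynomial.aeval_X, MvPolynomial.constantCoeff_X, mul_zero, map_zero,
        sub_zero, Algebra.smul_def]
      ring
    rw [heq]
    refine ⟨((hq1.mul (hX i)).add ((hX i).smul r)).mono ?_,
      ((SobolevLE.mul hσ hq1 hq2 (hX i) (hB i)).add ((hB i).smul r)).mono ?_⟩
    · have h3 : 2 * (C * X) * X ≤ 2 * C * |M| * X := by
        have : X ≤ |M| := hXM.trans (le_abs_self M)
        have h4 : 0 ≤ C * X := mul_nonneg hC hX0
        nlinarith
      have h5 : 0 ≤ (2 * (2 * (2 ^ σ) ^ 2 * (M ^ 2 * C + (C * M) ^ 2)) + 2 * r ^ 2) * X := by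
        positivity
      linarith
    · have h3 : X ^ 2 * (C * B) ≤ M ^ 2 * (C * B) :=
        mul_le_mul_of_nonneg_right hXX (mul_nonneg hC hB0)
      have h4 : (C * X) ^ 2 * B ≤ (C * M) ^ 2 * B := by
        rw [mul_pow, mul_pow]
        gcongr
      have h5 : 0 ≤ (2 * C * |M| + |r|) * B := by positivity
      have h6 : 2 * (2 * (2 ^ σ) ^ 2 * (X ^ 2 * (C * B) + (C * X) ^ 2 * B)) ≤
          2 * (2 * (2 ^ σ) ^ 2 * (M ^ 2 * (C * B) + (C * M) ^ 2 * B)) := by gcongr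
      linarith

end SequenceNorms

/-! ### The commutator form -/

section Energy

variable {d n : ℕ} {σ : ℝ}

/-- The commutator of `f ∂_j` with the weight, as a trilinear form in the coefficients. Its kernel
vanishes on the diagonal, so that constant terms of `f` do not contribute. -/
theorem sum_norm_commutator_le (hσ : 1 ≤ σ) {f : TrigPoly d} {c e : (Fin d → ℤ) → ℂ}
    {X Y B D : ℝ} (j : Fin d) (hfY : WienerLE f Y) (hfD : SobolevLE σ f D) (hX : 0 ≤ X)
    (hc1 : ∀ S : Finset (Fin d → ℤ), ∑ k ∈ S, bracket k * ‖c k‖ ≤ X)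
    (hc2 : ∀ S : Finset (Fin d → ℤ), ∑ k ∈ S, (bracket k ^ σ * ‖c k‖) ^ 2 ≤ B)
    (he1 : ∀ S : Finset (Fin d → ℤ), ∑ k ∈ S, bracket k * ‖e k‖ ≤ X)
    (he2 : ∀ S : Finset (Fin d → ℤ), ∑ k ∈ S, (bracket k ^ σ * ‖e k‖) ^ 2 ≤ B)
    (S : Finset (Fin d → ℤ)) :
    ∑ k ∈ S, ∑ m ∈ S, |bracketSq k ^ σ * m j - bracketSq m ^ σ * k j| *
      (‖c k‖ * ‖f.coeff (k - m)‖ * ‖e m‖) ≤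
      (2 * σ * 2 ^ σ + 1 + 2 * 2 ^ σ) * (Y * B + 2 * (X * (√B * √D))) := by
  have hw : ∀ k : Fin d → ℤ, 0 ≤ bracket k ^ σ := fun k => Real.rpow_nonneg (bracket_pos k).le _
  have hb : ∀ k : Fin d → ℤ, 0 ≤ bracket k := fun k => (bracket_pos k).le
  have hY := hfY.nonneg
  have hB : 0 ≤ B := by simpa using hc2 ∅
  have hC : 0 ≤ 2 * σ * 2 ^ σ + 1 + 2 * 2 ^ σ := by positivity
  have T1 : ∑ k ∈ S, ∑ m ∈ S, (bracket k ^ σ * ‖c k‖) *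
      ((bracket (k - m) * ‖f.coeff (k - m)‖) * (bracket m ^ σ * ‖e m‖)) ≤ Y * (√B * √B) :=
    sum_sum_le_of_sum_conv_sq_le (c := fun k => bracket k ^ σ * ‖c k‖)
      (b := fun k => bracket k * ‖f.coeff k‖) (a := fun k => bracket k ^ σ * ‖e k‖) hc2 hY
      (fun S' => sum_conv_sq_le' (a := fun k => bracket k ^ σ * ‖e k‖)
        (b := fun k => bracket k * ‖f.coeff k‖)
        (fun k => mul_nonneg (hb k) (norm_nonneg _)) he2 hfY S' S) S
  have T2 : ∑ k ∈ S, ∑ m ∈ S, (bracket k ^ σ * ‖c k‖) *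
      ((bracket (k - m) ^ σ * ‖f.coeff (k - m)‖) * (bracket m * ‖e m‖)) ≤ X * (√B * √D) := by
    have h := fun S' => sum_conv_sq_le (a := fun k => bracket k ^ σ * ‖f.coeff k‖)
      (b := fun k => bracket k * ‖e k‖) (fun k => mul_nonneg (hb k) (norm_nonneg _)) hfD he1 S' S
    calc _ = ∑ k ∈ S, (bracket k ^ σ * ‖c k‖) * ∑ m ∈ S,
          (bracket (k - m) ^ σ * ‖f.coeff (k - m)‖) * (bracket m * ‖e m‖) := by
          simp only [Finset.mul_sum]
      _ ≤ _ := Real.sum_mul_le_sqrt_mul_sqrt _ _ _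
      _ ≤ √B * √(X ^ 2 * D) := by
          gcongr
          · exact hc2 S
          · exact h S
      _ = X * (√B * √D) := by
          rw [Real.sqrt_mul (sq_nonneg _), Real.sqrt_sq hX]; ring
  -- The first factor is now the one in the Wiener algebra: exchange `k` and `m`, and reflect `f`.
  have T3 : ∑ k ∈ S, ∑ m ∈ S, (bracket m ^ σ * ‖e m‖) *
      ((bracket (k - m) ^ σ * ‖f.coeff (k - m)‖) * (bracket k * ‖c k‖)) ≤ X * (√B * √D) := by
    have hrefl : ∀ S' : Finset (Fin d → ℤ),
        ∑ k ∈ S', (bracket k ^ σ * ‖f.coeff (-k)‖) ^ 2 ≤ D := fun S' => by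
      have := sum_reflect_le (φ := fun k => (bracket k ^ σ * ‖f.coeff k‖) ^ 2) hfD S' 0
      simpa only [zero_sub, bracket_neg] using this
    have h := fun S' => sum_conv_sq_le (a := fun k => bracket k ^ σ * ‖f.coeff (-k)‖)
      (b := fun k => bracket k * ‖c k‖) (fun k => mul_nonneg (hb k) (norm_nonneg _)) hrefl hc1 S' S
    rw [Finset.sum_comm]
    calc _ = ∑ m ∈ S, (bracket m ^ σ * ‖e m‖) * ∑ k ∈ S,
          (bracket (m - k) ^ σ * ‖f.coeff (-(m - k))‖) * (bracket k * ‖c k‖) := by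
          simp only [Finset.mul_sum, neg_sub]
          refine Finset.sum_congr rfl fun m _ => Finset.sum_congr rfl fun k _ => ?_
          rw [← bracket_neg (k - m), neg_sub]
      _ ≤ _ := Real.sum_mul_le_sqrt_mul_sqrt _ _ _
      _ ≤ √B * √(X ^ 2 * D) := by
          gcongr
          · exact he2 S
          · exact h S
      _ = X * (√B * √D) := by
          rw [Real.sqrt_mul (sq_nonneg _), Real.sqrt_sq hX]; ring
  rw [Real.mul_self_sqrt hB] at T1
  calc _ ≤ ∑ k ∈ S, ∑ m ∈ S, (2 * σ * 2 ^ σ + 1 + 2 * 2 ^ σ) *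
        ((bracket k ^ σ * ‖c k‖) *
          ((bracket (k - m) * ‖f.coeff (k - m)‖) * (bracket m ^ σ * ‖e m‖)) +
        (bracket k ^ σ * ‖c k‖) *
          ((bracket (k - m) ^ σ * ‖f.coeff (k - m)‖) * (bracket m * ‖e m‖)) +
        (bracket m ^ σ * ‖e m‖) *
          ((bracket (k - m) ^ σ * ‖f.coeff (k - m)‖) * (bracket k * ‖c k‖))) := by
        refine Finset.sum_le_sum fun k _ => Finset.sum_le_sum fun m _ => ?_
        have hker := abs_kernel_le (x := m j) (y := k j) hσ (one_le_bracket k) (one_le_bracket m)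
          (one_le_bracket (k - m)) (bracket_le_add k m)
          (by rw [← bracket_neg (k - m), neg_sub]; exact bracket_le_add m k)
          (abs_le_bracket m j) (abs_le_bracket k j)
          (by rw [abs_sub_comm]; simpa using abs_le_bracket (k - m) j)
        rw [bracket_rpow_sq, bracket_rpow_sq] at hker
        refine (mul_le_mul_of_nonneg_right hker (by positivity)).trans_eq ?_
        ring
    _ ≤ _ := by
        simp only [← Finset.mul_sum, Finset.sum_add_distrib] at T1 T2 T3 ⊢
        refine mul_le_mul_of_nonneg_left ?_ hC
        linarith

end Energy

/-! ### The energy estimate -/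

section EnergyEstimate

variable {d n : ℕ} {σ : ℝ}

/-- The Sobolev embedding `H^σ ⊆ ` Wiener algebra with one derivative, for `σ > d/2 + 1`. -/
theorem exists_wienerLE_truncation (hσ : (d : ℝ) / 2 + 1 < σ) : ∃ K : ℝ, 0 < K ∧
    ∀ (N : ℕ) (y : (Fin d → ℤ) → Fin n → ℂ) (a : Fin n), WienerLE (truncation N y a)
      (K * √(∑ k ∈ box d N, bracketSq k ^ σ * ∑ a, ‖y k a‖ ^ 2)) := by
  obtain ⟨K, hK, hsum⟩ := exists_sum_bracketSq_rpow_le (d := d) (σ := σ - 1) (by linarith)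
  refine ⟨√K + 1, by positivity, fun N y a S => ?_⟩
  have hle : ∑ k ∈ S, bracket k * ‖(truncation N y a).coeff k‖ ≤
      ∑ k ∈ box d N, bracket k * ‖y k a‖ := by
    have h1 : ∀ k, bracket k * ‖(truncation N y a).coeff k‖ =
        if k ∈ box d N then bracket k * ‖y k a‖ else 0 := fun k => by
      rw [coeff_truncation]; split_ifs <;> simp
    simp only [h1]
    rw [← Finset.sum_filter]
    refine Finset.sum_le_sum_of_subset_of_nonneg (fun k hk => (Finset.mem_filter.1 hk).2)
      fun k _ _ => mul_nonneg (bracket_pos k).le (norm_nonneg _)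
  have hterm : ∀ k : Fin d → ℤ, bracket k * ‖y k a‖ =
      bracket k ^ (1 - σ) * (bracket k ^ σ * ‖y k a‖) := fun k => by
    rw [← mul_assoc, ← Real.rpow_add (bracket_pos k)]
    simp
  calc _ ≤ ∑ k ∈ box d N, bracket k * ‖y k a‖ := hle
    _ = ∑ k ∈ box d N, bracket k ^ (1 - σ) * (bracket k ^ σ * ‖y k a‖) := by simp only [hterm]
    _ ≤ √(∑ k ∈ box d N, (bracket k ^ (1 - σ)) ^ 2) *
        √(∑ k ∈ box d N, (bracket k ^ σ * ‖y k a‖) ^ 2) := Real.sum_mul_le_sqrt_mul_sqrt _ _ _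
    _ ≤ √K * √(∑ k ∈ box d N, bracketSq k ^ σ * ∑ a, ‖y k a‖ ^ 2) := by
        gcongr with k _
        · refine (Finset.sum_congr rfl fun k _ => ?_).trans_le (hsum (box d N))
          rw [bracket_rpow_sq]; congr 1; ring
        · rw [mul_pow, bracket_rpow_sq]
          refine mul_le_mul_of_nonneg_left ?_ (Real.rpow_nonneg (bracketSq_pos k).le _)
          exact Finset.single_le_sum (f := fun a => ‖y k a‖ ^ 2) (fun _ _ => sq_nonneg _)
            (Finset.mem_univ a)
    _ ≤ _ := by gcongr; linarith

theorem sobolevLE_truncation (N : ℕ) (y : (Fin d → ℤ) → Fin n → ℂ) (a : Fin n) :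
    SobolevLE σ (truncation N y a) (∑ k ∈ box d N, bracketSq k ^ σ * ∑ a, ‖y k a‖ ^ 2) := by
  intro S
  have h1 : ∀ k, (bracket k ^ σ * ‖(truncation N y a).coeff k‖) ^ 2 =
      if k ∈ box d N then bracketSq k ^ σ * ‖y k a‖ ^ 2 else 0 := fun k => by
    rw [coeff_truncation, mul_pow, bracket_rpow_sq]; split_ifs <;> simp
  have hw : ∀ k : Fin d → ℤ, 0 ≤ bracketSq k ^ σ := fun k => Real.rpow_nonneg (bracketSq_pos k).le _
  simp only [h1]
  rw [← Finset.sum_filter]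
  refine (Finset.sum_le_sum_of_subset_of_nonneg (fun k hk => (Finset.mem_filter.1 hk).2)
    fun k _ _ => mul_nonneg (hw k) (sq_nonneg _)).trans (Finset.sum_le_sum fun k _ =>
      mul_le_mul_of_nonneg_left ?_ (hw k))
  exact Finset.single_le_sum (f := fun a => ‖y k a‖ ^ 2) (fun _ _ => sq_nonneg _)
    (Finset.mem_univ a)

/-- Integration by parts on the Fourier side: symmetry of the matrices turns twice the real part
of the energy product into a sum over the commutator kernel. -/
theorem two_re_energy_eq {p : Fin d → Fin n → Fin n → MvPolynomial (Fin n) ℝ}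
    (hsym : ∀ j a b, p j a b = p j b a) (N : ℕ) {y : (Fin d → ℤ) → Fin n → ℂ} (hy : ConjSymm y)
    (w : (Fin d → ℤ) → ℝ) :
    ((2 * ∑ k ∈ box d N, w k * ∑ a,
      ((starRingEnd ℂ) (y k a) * (quasilinearPoly p N y a).coeff k).re : ℝ) : ℂ) =
    ∑ j, ∑ a, ∑ b, ∑ k ∈ box d N, ∑ m ∈ box d N,
      (Complex.I * ((w k * m j - w m * k j : ℝ) : ℂ)) * ((starRingEnd ℂ) (y k a) *
        (MvPolynomial.aeval (truncation N y) (p j a b)).coeff (k - m) * y m b) := by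
  let T : Fin d → Fin n → Fin n → (Fin d → ℤ) → (Fin d → ℤ) → ℂ := fun j a b k m =>
    (w k : ℂ) * ((starRingEnd ℂ) (y k a) *
      ((MvPolynomial.aeval (truncation N y) (p j a b)).coeff (k - m) *
        (Complex.I * (m j : ℂ) * y m b)))
  have hZ : ∑ k ∈ box d N, (w k : ℂ) * ∑ a,
      ((starRingEnd ℂ) (y k a) * (quasilinearPoly p N y a).coeff k) =
      ∑ j, ∑ a, ∑ b, ∑ k ∈ box d N, ∑ m ∈ box d N, T j a b k m := by
    have hQ : ∀ k a, (quasilinearPoly p N y a).coeff k = ∑ j, ∑ b, ∑ m ∈ box d N,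
        (MvPolynomial.aeval (truncation N y) (p j a b)).coeff (k - m) *
          (Complex.I * (m j : ℂ) * y m b) := by
      intro k a
      simp only [quasilinearPoly, AddMonoidAlgebra.coeff_sum, Finsupp.finsetSum_apply]
      refine Finset.sum_congr rfl fun j _ => Finset.sum_congr rfl fun b _ => ?_
      rw [coeff_mul_of_support _ _ (coeff_truncation_of_notMem N _ b)]
      refine Finset.sum_congr rfl fun m hm => ?_
      rw [coeff_truncation, if_pos hm]
    simp only [hQ, Finset.mul_sum, T]
    calc _ = ∑ k ∈ box d N, ∑ j, ∑ a, ∑ b, ∑ m ∈ box d N, T j a b k m :=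
          Finset.sum_congr rfl fun k _ => Finset.sum_comm
      _ = ∑ j, ∑ k ∈ box d N, ∑ a, ∑ b, ∑ m ∈ box d N, T j a b k m := Finset.sum_comm
      _ = ∑ j, ∑ a, ∑ k ∈ box d N, ∑ b, ∑ m ∈ box d N, T j a b k m :=
          Finset.sum_congr rfl fun j _ => Finset.sum_comm
      _ = _ := Finset.sum_congr rfl fun j _ => Finset.sum_congr rfl fun a _ => Finset.sum_comm
  have hre : (2 * ∑ k ∈ box d N, w k * ∑ a,
      ((starRingEnd ℂ) (y k a) * (quasilinearPoly p N y a).coeff k).re : ℝ) =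
      2 * (∑ j, ∑ a, ∑ b, ∑ k ∈ box d N, ∑ m ∈ box d N, T j a b k m).re := by
    rw [← hZ]
    simp only [Complex.re_sum, Complex.re_ofReal_mul]
  -- Conjugate, and rename `a ↔ b` and `k ↔ m`.
  have hswap : (starRingEnd ℂ) (∑ j, ∑ a, ∑ b, ∑ k ∈ box d N, ∑ m ∈ box d N, T j a b k m) =
      ∑ j, ∑ a, ∑ b, ∑ k ∈ box d N, ∑ m ∈ box d N, (starRingEnd ℂ) (T j b a m k) := by
    simp only [map_sum]
    refine Finset.sum_congr rfl fun j _ => ?_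
    rw [Finset.sum_comm]
    exact Finset.sum_congr rfl fun a _ => Finset.sum_congr rfl fun b _ => Finset.sum_comm
  rw [hre, ← Complex.add_conj, hswap]
  simp only [← Finset.sum_add_distrib]
  refine Finset.sum_congr rfl fun j _ => Finset.sum_congr rfl fun a _ =>
    Finset.sum_congr rfl fun b _ => Finset.sum_congr rfl fun k _ =>
    Finset.sum_congr rfl fun m _ => ?_
  have hconj := conjSymm_coeff_aeval hy N (p j b a) (m - k)
  rw [neg_sub, hsym j b a] at hconj
  simp only [T, map_mul, Complex.conj_conj, Complex.conj_ofReal, Complex.conj_I, map_intCast]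
  rw [hsym j b a, ← hconj]
  push_cast
  ring

theorem coeff_algebraMap_of_ne {l : Fin d → ℤ} (hl : l ≠ 0) (r : ℝ) :
    (algebraMap ℝ (TrigPoly d) r).coeff l = 0 := by
  rw [Algebra.algebraMap_eq_smul_one, AddMonoidAlgebra.one_def, AddMonoidAlgebra.smul_single,
    AddMonoidAlgebra.coeff_single, Finsupp.single_apply, if_neg hl.symm]

/-- The energy estimate, uniform in the truncation: `X` bounds the solution in the Wiener algebra
and enters linearly. -/
theorem exists_energy_le (hσ : 1 ≤ σ) {p : Fin d → Fin n → Fin n → MvPolynomial (Fin n) ℝ}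
    (hsym : ∀ j a b, p j a b = p j b a) (M : ℝ) : ∃ K : ℝ, 0 ≤ K ∧
    ∀ (N : ℕ) (y : (Fin d → ℤ) → Fin n → ℂ) (X : ℝ), ConjSymm y → 0 ≤ X → X ≤ M →
      (∀ a, WienerLE (truncation N y a) X) →
      |2 * ∑ k ∈ box d N, bracketSq k ^ σ * ∑ a,
        ((starRingEnd ℂ) (y k a) * (quasilinearPoly p N y a).coeff k).re| ≤
      K * X * ∑ k ∈ box d N, bracketSq k ^ σ * ∑ a, ‖y k a‖ ^ 2 := by
  choose C hC hbound using fun j a b =>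
    exists_aeval_sub_le (d := d) (σ := σ) (by linarith) M (p j a b)
  refine ⟨∑ j, ∑ a, ∑ b, (2 * σ * 2 ^ σ + 1 + 2 * 2 ^ σ) * (C j a b + 2 * √(C j a b)), ?_,
    fun N y X hy hX0 hXM hX => ?_⟩
  · refine Finset.sum_nonneg fun j _ => Finset.sum_nonneg fun a _ => Finset.sum_nonneg fun b _ => ?_
    have := hC j a b
    positivity
  set B := ∑ k ∈ box d N, bracketSq k ^ σ * ∑ a, ‖y k a‖ ^ 2 with hBdef
  have hB : ∀ a, SobolevLE σ (truncation N y a) B := sobolevLE_truncation N y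
  have hB0 : 0 ≤ B := Finset.sum_nonneg fun k _ =>
    mul_nonneg (Real.rpow_nonneg (bracketSq_pos k).le _) (by positivity)
  rw [← Real.norm_eq_abs, ← Complex.norm_real, two_re_energy_eq hsym N hy]
  simp only [Finset.sum_mul]
  refine (norm_sum_le _ _).trans (Finset.sum_le_sum fun j _ => (norm_sum_le _ _).trans
    (Finset.sum_le_sum fun a _ => (norm_sum_le _ _).trans (Finset.sum_le_sum fun b _ => ?_)))
  obtain ⟨hf1, hf2⟩ := hbound j a b (truncation N y) X B hXM hX hX0 hB0 hB
  set f := MvPolynomial.aeval (truncation N y) (p j a b) -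
    algebraMap ℝ (TrigPoly d) (MvPolynomial.constantCoeff (p j a b)) with hf
  have hmain := sum_norm_commutator_le hσ j hf1 hf2 hX0 (hX a) (hB a) (hX b) (hB b) (box d N)
  calc _ ≤ ∑ k ∈ box d N, ∑ m ∈ box d N, ‖(Complex.I *
        ((bracketSq k ^ σ * m j - bracketSq m ^ σ * k j : ℝ) : ℂ)) * ((starRingEnd ℂ) (y k a) *
        (MvPolynomial.aeval (truncation N y) (p j a b)).coeff (k - m) * y m b)‖ :=
        (norm_sum_le _ _).trans (Finset.sum_le_sum fun k _ => norm_sum_le _ _)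
    _ = ∑ k ∈ box d N, ∑ m ∈ box d N, |bracketSq k ^ σ * m j - bracketSq m ^ σ * k j| *
        (‖(truncation N y a).coeff k‖ * ‖f.coeff (k - m)‖ * ‖(truncation N y b).coeff m‖) := by
        refine Finset.sum_congr rfl fun k hk => Finset.sum_congr rfl fun m hm => ?_
        rw [coeff_truncation, coeff_truncation, if_pos hk, if_pos hm]
        simp only [norm_mul, Complex.norm_I, one_mul, Complex.norm_real, Real.norm_eq_abs,
          RCLike.norm_conj]
        -- The kernel vanishes on the diagonal, and off it `f` and the polynomial of the solution
        -- have the same coefficients.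
        rcases eq_or_ne k m with rfl | hkm
        · simp
        · rw [hf, AddMonoidAlgebra.coeff_sub, Finsupp.sub_apply,
            coeff_algebraMap_of_ne (sub_ne_zero.2 hkm), sub_zero]
    _ ≤ _ := hmain
    _ = _ := by
        rw [Real.sqrt_mul (hC j a b)]
        have := Real.mul_self_sqrt hB0
        linear_combination (2 * σ * 2 ^ σ + 1 + 2 * 2 ^ σ) * 2 * X * √(C j a b) * this

end EnergyEstimate

/-! ### The energy along solutions -/

section Dynamics

variable {d n : ℕ} {A : Fin d → EuclideanSpace ℝ (Fin n) → Matrix (Fin n) (Fin n) ℝ}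
  {p : Fin d → Fin n → Fin n → MvPolynomial (Fin n) ℝ} {s σ : ℝ} {N : ℕ} {U₀ : L2 d n} {I : Set ℝ}
  {U : ℝ → L2 d n}

theorem IsFlowLine.hasDerivAt_boxEnergy
    (hp : ∀ j a b u, A j u a b = MvPolynomial.eval (fun i => u i) (p j a b)) (σ : ℝ)
    (h : IsFlowLine (filteredField p N) (sharpFilter N U₀) I U) {t : ℝ} (ht : t ∈ I) :
    HasDerivAt (fun t => boxEnergy σ N (U t))
      (-(2 * ∑ k ∈ box d N, bracketSq k ^ σ * ∑ a, ((starRingEnd ℂ) (fourierCoefficient (U t) k a) *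
        (quasilinearPoly p N (fourierCoefficient (U t)) a).coeff k).re)) t := by
  have hterm : ∀ k ∈ box d N, HasDerivAt
      (fun t => bracketSq k ^ σ * ∑ a, ‖fourierCoefficient (U t) k a‖ ^ 2)
      (bracketSq k ^ σ * ∑ a, -(2 * ((starRingEnd ℂ) (fourierCoefficient (U t) k a) *
        (quasilinearPoly p N (fourierCoefficient (U t)) a).coeff k).re)) t := by
    intro k hk
    refine HasDerivAt.const_mul _ (HasDerivAt.fun_sum fun a _ => ?_)
    have h1 : HasDerivAt (fun t => fourierCoefficient (U t) k a)
        (-(quasilinearPoly p N (fourierCoefficient (U t)) a).coeff k) t := by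
      have := (coeffL k a).hasFDerivAt.comp_hasDerivAt t (h.hasDerivAt t ht)
      rw [coeffL_apply, fourierCoefficient_filteredField hp N (U t) hk] at this
      simpa only [Function.comp_def, coeffL_apply] using this
    convert! h1.norm_sq using 1
    rw [Complex.inner]
    simp [mul_comm]
    ring
  convert! HasDerivAt.fun_sum hterm using 1
  rw [Finset.mul_sum, ← Finset.sum_neg_distrib]
  refine Finset.sum_congr rfl fun k _ => ?_
  rw [Finset.sum_neg_distrib, ← Finset.mul_sum]
  ring

/-- The differential inequality for the energies along a solution. -/
theorem exists_abs_deriv_boxEnergy_le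
    (hp : ∀ j a b u, A j u a b = MvPolynomial.eval (fun i => u i) (p j a b))
    (hsym : ∀ j a b, p j a b = p j b a) (hs : (d : ℝ) / 2 + 1 < s) (hσ : 1 ≤ σ) (R : ℝ) :
    ∃ K : ℝ, 0 < K ∧ ∀ (N : ℕ) (U₀ : L2 d n) (I : Set ℝ) (U : ℝ → L2 d n),
      IsFlowLine (filteredField p N) (sharpFilter N U₀) I U → ∀ t ∈ I,
        √(boxEnergy s N (U t)) ≤ R → |deriv (fun t => boxEnergy σ N (U t)) t| ≤
          K * √(boxEnergy s N (U t)) * boxEnergy σ N (U t) := by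
  obtain ⟨K₁, hK₁, hw⟩ := exists_wienerLE_truncation (d := d) (n := n) hs
  obtain ⟨K₂, hK₂, he⟩ := exists_energy_le (σ := σ) hσ hsym (K₁ * R)
  refine ⟨K₂ * K₁ + 1, by positivity, fun N U₀ I U h t ht hR => ?_⟩
  rw [(h.hasDerivAt_boxEnergy hp σ ht).deriv, abs_neg]
  refine (he N (fourierCoefficient (U t)) (K₁ * √(boxEnergy s N (U t)))
    (conjSymm_fourierCoefficient _) (by positivity) (by gcongr) fun a => hw N _ a).trans ?_
  have := mul_nonneg (Real.sqrt_nonneg (boxEnergy s N (U t))) (boxEnergy_nonneg σ N (U t))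
  change K₂ * (K₁ * √(boxEnergy s N (U t))) * boxEnergy σ N (U t) ≤ _
  nlinarith

end Dynamics

/-! ### Uniform bounds and propagation of regularity -/

section Conclusions

variable {d n : ℕ} {A : Fin d → EuclideanSpace ℝ (Fin n) → Matrix (Fin n) (Fin n) ℝ}
  {p : Fin d → Fin n → Fin n → MvPolynomial (Fin n) ℝ} {s : ℝ} {N : ℕ} {U₀ : L2 d n} {I : Set ℝ}
  {U : ℝ → L2 d n}

/-- Low-pass functions of bounded energy lie in a compact subset of `L²`. -/
theorem exists_isCompact_lowPass (N : ℕ) (R : ℝ) : ∃ K : Set (L2 d n), IsCompact K ∧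
    ∀ u : L2 d n, sharpFilter N u = u → 0 ≤ s → √(boxEnergy s N u) ≤ R → u ∈ K := by
  let P : Set ((Fin d → ℤ) → Fin n → ℂ) :=
    Set.pi Set.univ fun _ => Set.pi Set.univ fun _ => Metric.closedBall 0 R
  have hP : IsCompact P := isCompact_univ_pi fun _ => isCompact_univ_pi fun _ =>
    isCompact_closedBall 0 R
  have hcont : Continuous fun y : (Fin d → ℤ) → Fin n → ℂ => synth N y :=
    continuous_finsetSum _ fun k _ => continuous_finsetSum _ fun a _ =>
      (mode k a).continuous.comp (by fun_prop)
  refine ⟨synth N '' P, hP.image hcont, fun u hu hs hR => ⟨fourierCoefficient u, ?_, ?_⟩⟩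
  · intro k _ a _
    rw [mem_closedBall_zero_iff]
    refine le_trans ?_ hR
    by_cases hk : k ∈ box d N
    · refine Real.le_sqrt_of_sq_le ?_
      calc ‖fourierCoefficient u k a‖ ^ 2 ≤ ∑ a, ‖fourierCoefficient u k a‖ ^ 2 :=
            Finset.single_le_sum (f := fun a => ‖fourierCoefficient u k a‖ ^ 2)
              (fun _ _ => sq_nonneg _) (Finset.mem_univ a)
        _ ≤ bracketSq k ^ s * ∑ a, ‖fourierCoefficient u k a‖ ^ 2 :=
            le_mul_of_one_le_left (by positivity) (Real.one_le_rpow (one_le_bracketSq k) hs)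
        _ ≤ boxEnergy s N u := Finset.single_le_sum (f := fun k =>
            bracketSq k ^ s * ∑ a, ‖fourierCoefficient u k a‖ ^ 2)
            (fun k _ => energy_term_nonneg s u k) hk
    · rw [← hu, fourierCoefficient_sharpFilter, if_neg hk, norm_zero]
      positivity
  · rw [← sharpFilter_eq_synth, hu]

theorem IsFlowLine.Icc_subset {F : L2 d n → L2 d n} {x₀ : L2 d n} (h : IsFlowLine F x₀ I U) {t : ℝ}
    (ht : t ∈ I) : Set.Icc 0 t ⊆ I := h.isInterval.out h.zero_mem ht

theorem IsFlowLine.boxEnergy_zero_eq {F : L2 d n → L2 d n}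
    (h : IsFlowLine F (sharpFilter N U₀) I U) (σ : ℝ) :
    boxEnergy σ N (U 0) = boxEnergy σ N U₀ := by
  rw [h.initial, boxEnergy_sharpFilter]

/-- The bound by comparison with `m² exp(2Cmt)`: where the energy touches this barrier, the
solution has size at most `2m` and the energy grows strictly slower than the barrier. -/
theorem IsFlowLine.boxEnergy_le_exp
    (hp : ∀ j a b u, A j u a b = MvPolynomial.eval (fun i => u i) (p j a b))
    (h : IsFlowLine (filteredField p N) (sharpFilter N U₀) I U) {K M m : ℝ} (hK : 0 < K)
    (hbound : ∀ t ∈ I, √(boxEnergy s N (U t)) ≤ 2 * M →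
      |deriv (fun t => boxEnergy s N (U t)) t| ≤
        K * √(boxEnergy s N (U t)) * boxEnergy s N (U t))
    (hm : 0 < m) (hmM : m ≤ M) (h0 : √(boxEnergy s N U₀) ≤ m) {t : ℝ} (ht : t ∈ I) (ht0 : 0 ≤ t)
    (hT : 2 * K * m * t ≤ Real.log 2) :
    √(boxEnergy s N (U t)) ≤ m * Real.exp (2 * K * m * t) := by
  have hexp : ∀ x : ℝ, (m * Real.exp (2 * K * m * x)) ^ 2 =
      m ^ 2 * Real.exp (4 * K * m * x) := fun x => by
    rw [mul_pow, ← Real.exp_nat_mul]; congr 2; push_cast; ring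
  have hsub := h.Icc_subset ht
  have hd : ∀ x ∈ I, HasDerivAt (fun t => boxEnergy s N (U t))
      (deriv (fun t => boxEnergy s N (U t)) x) x := fun x hx =>
    (h.hasDerivAt_boxEnergy hp s hx).differentiableAt.hasDerivAt
  have key := image_le_of_deriv_right_lt_deriv_boundary
    (f := fun t => boxEnergy s N (U t)) (f' := deriv fun t => boxEnergy s N (U t))
    (a := 0) (b := t) (B := fun x => m ^ 2 * Real.exp (4 * K * m * x))
    (B' := fun x => m ^ 2 * (Real.exp (4 * K * m * x) * (4 * K * m)))
    (fun x hx => (hd x (hsub hx)).continuousAt.continuousWithinAt)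
    (fun x hx => (hd x (hsub (Set.Ico_subset_Icc_self hx))).hasDerivWithinAt)
    (by
      simp only [mul_zero, Real.exp_zero, mul_one, h.boxEnergy_zero_eq]
      exact (Real.sqrt_le_left hm.le).1 h0)
    (fun x => by
      have h1 : HasDerivAt (fun x : ℝ => 4 * K * m * x) (4 * K * m) x := by
        simpa using (hasDerivAt_id x).const_mul (4 * K * m)
      exact h1.exp.const_mul _)
    (fun x hx heq => by
      have hxI := hsub (Set.Ico_subset_Icc_self hx)
      have hsqrt : √(boxEnergy s N (U x)) = m * Real.exp (2 * K * m * x) := by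
        rw [heq, ← hexp, Real.sqrt_sq (by positivity)]
      have hle2 : Real.exp (2 * K * m * x) ≤ 2 := by
        rw [← Real.le_log_iff_exp_le two_pos]
        refine le_trans ?_ hT
        have := hx.2.le
        gcongr
      have hle : √(boxEnergy s N (U x)) ≤ 2 * m := by rw [hsqrt]; nlinarith
      have hb := (le_abs_self _).trans (hbound x hxI (hle.trans (by linarith)))
      have hE : 0 < boxEnergy s N (U x) := by rw [heq]; positivity
      calc _ ≤ K * √(boxEnergy s N (U x)) * boxEnergy s N (U x) := hb
        _ ≤ K * (2 * m) * boxEnergy s N (U x) := by gcongr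
        _ < 4 * K * m * boxEnergy s N (U x) := by
          have := mul_pos (mul_pos hK hm) hE
          nlinarith
        _ = _ := by rw [heq]; ring)
    (Set.right_mem_Icc.2 ht0)
  rw [Real.sqrt_le_left (by positivity), hexp]
  exact key

theorem filteredField_zero
    (p : Fin d → Fin n → Fin n → MvPolynomial (Fin n) ℝ) (N : ℕ) :
    filteredField p N (0 : L2 d n) = 0 := by
  have h0 : ∀ k a, fourierCoefficient (0 : L2 d n) k a = 0 := fun k a => by
    rw [← coeffL_apply, map_zero]
  simp only [filteredField, quasilinearPoly, truncation, h0, mul_zero]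
  simp [synth]

theorem sharpFilter_eq_zero_of_hsNorm (hU₀ : hsNorm s U₀ = 0) : sharpFilter N U₀ = 0 := by
  have h := ofReal_sqrt_boxEnergy_le s N U₀
  rw [hU₀, nonpos_iff_eq_zero, ENNReal.ofReal_eq_zero, Real.sqrt_le_left le_rfl] at h
  refine ext_fourierCoefficient fun k a => ?_
  rw [fourierCoefficient_sharpFilter, ← coeffL_apply k a (0 : L2 d n), map_zero]
  split_ifs with hk
  · have h1 := (Finset.sum_eq_zero_iff_of_nonneg fun k _ => energy_term_nonneg s U₀ k).1
      (le_antisymm (h.trans (by norm_num)) (boxEnergy_nonneg s N U₀)) k hk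
    have h2 := (mul_eq_zero.1 h1).resolve_left (Real.rpow_pos_of_pos (bracketSq_pos k) s).ne'
    have h3 := (Finset.sum_eq_zero_iff_of_nonneg fun _ _ => sq_nonneg _).1 h2 a (Finset.mem_univ a)
    simpa using h3
  · rfl

/-- The solution on the largest interval of existence is the unique maximal solution. -/
theorem exists_unique_isMaximalSolution
    (hp : ∀ j a b u, A j u a b = MvPolynomial.eval (fun i => u i) (p j a b)) (s : ℝ) (N : ℕ)
    (U₀ : L2 d n) : ∃ (I : Set ℝ) (U : ℝ → L2 d n), IsMaximalSolution A s N U₀ I U ∧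
      (∀ (J : Set ℝ) (V : ℝ → L2 d n), IsMaximalSolution A s N U₀ J V → J = I ∧ Set.EqOn V U I) ∧
      IsFlowLine (filteredField p N) (sharpFilter N U₀) I U ∧
      ∀ (J : Set ℝ) (V : ℝ → L2 d n), IsFlowLine (filteredField p N) (sharpFilter N U₀) J V →
        J ⊆ I ∧ Set.EqOn V U J := by
  obtain ⟨I, U, hU, hmax⟩ := exists_greatest_isFlowLine
    (contDiff_filteredField (p := p) N) (sharpFilter N U₀)
  refine ⟨I, U, ⟨hU.isSolution hp s, fun J V hV hIJ _ =>
    ((hmax J V (hV.isFlowLine hp)).1).antisymm hIJ⟩, fun J V hV => ?_, hU, hmax⟩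
  obtain ⟨hJI, heq⟩ := hmax J V (hV.1.isFlowLine hp)
  have hJ : I = J := hV.2 I U (hU.isSolution hp s) hJI heq.symm
  exact ⟨hJ.symm, hJ ▸ heq⟩

/-- Existence, uniqueness and the `H^s` bound on a time interval independent of `N`. -/
theorem exists_uniform_bound
    (hp : ∀ j a b u, A j u a b = MvPolynomial.eval (fun i => u i) (p j a b))
    (hsym : ∀ j a b, p j a b = p j b a) (hs : (d : ℝ) / 2 + 1 < s) {M : ℝ} (hM : 0 < M) :
    ∃ C : ℝ, 0 < C ∧ ∃ T : ℝ, 0 < T ∧ ∀ (N : ℕ) (U₀ : L2 d n), hsNorm s U₀ ≤ ENNReal.ofReal M →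
      ∃ (I : Set ℝ) (U : ℝ → L2 d n), IsMaximalSolution A s N U₀ I U ∧
        (∀ (J : Set ℝ) (V : ℝ → L2 d n),
          IsMaximalSolution A s N U₀ J V → J = I ∧ Set.EqOn V U I) ∧
        ∀ t : ℝ, 0 ≤ t → t * (hsNorm s U₀).toReal ≤ T → t ∈ I ∧
          hsNorm s (U t) ≤
            hsNorm s U₀ * ENNReal.ofReal (Real.exp (C * (hsNorm s U₀).toReal * t)) ∧
          hsNorm s U₀ * ENNReal.ofReal (Real.exp (C * (hsNorm s U₀).toReal * t)) ≤
            2 * hsNorm s U₀ := by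
  have hd : (0 : ℝ) ≤ d := by positivity
  obtain ⟨K, hK, hbound⟩ := exists_abs_deriv_boxEnergy_le hp hsym hs
    (σ := s) (by linarith) (2 * M)
  -- `C = 2K` makes the barrier grow strictly faster; `T = log 2 / C` makes `exp (C m t) ≤ 2`.
  refine ⟨2 * K, by positivity, Real.log 2 / (2 * K),
    div_pos (Real.log_pos one_lt_two) (by positivity), fun N U₀ hU₀ => ?_⟩
  obtain ⟨I, U, h1, h2, hU, hmax⟩ := exists_unique_isMaximalSolution hp s N U₀
  refine ⟨I, U, h1, h2, fun t ht0 htT => ?_⟩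
  have hfin : hsNorm s U₀ ≠ ∞ := (hU₀.trans_lt ENNReal.ofReal_lt_top).ne
  set m := (hsNorm s U₀).toReal with hm
  have hmof : hsNorm s U₀ = ENNReal.ofReal m := (ENNReal.ofReal_toReal hfin).symm
  have hm0 : 0 ≤ m := ENNReal.toReal_nonneg
  have hmM : m ≤ M := by
    rw [hmof] at hU₀
    exact (ENNReal.ofReal_le_ofReal_iff hM.le).1 hU₀
  have hexp : 2 * K * m * t ≤ Real.log 2 := by
    rw [le_div_iff₀ (by positivity)] at htT
    linarith
  have hexp2 : Real.exp (2 * K * m * t) ≤ 2 := (Real.le_log_iff_exp_le two_pos).1 hexp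
  have hlast : hsNorm s U₀ * ENNReal.ofReal (Real.exp (2 * K * m * t)) ≤ 2 * hsNorm s U₀ := by
    have h3 : ENNReal.ofReal (Real.exp (2 * K * m * t)) ≤ 2 := by
      simpa using ENNReal.ofReal_le_ofReal hexp2
    rw [mul_comm 2 (hsNorm s U₀)]
    gcongr
  have hlow := hU.sharpFilter_eq hp
  -- For zero data the barrier degenerates, but the solution is the zero function, for all times.
  rcases hm0.eq_or_lt with hm0 | hm0
  · have hz : hsNorm s U₀ = 0 := by rw [hmof, ← hm0, ENNReal.ofReal_zero]
    have hzero : IsFlowLine (filteredField p N) (sharpFilter N U₀) Set.univ fun _ => 0 :=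
      ⟨isOpen_univ, Set.ordConnected_univ, Set.mem_univ _,
        (sharpFilter_eq_zero_of_hsNorm hz).symm, fun t _ => by
          rw [filteredField_zero]; exact hasDerivAt_const t 0⟩
    obtain ⟨hsub, heq⟩ := hmax _ _ hzero
    have htI : t ∈ I := hsub (Set.mem_univ t)
    refine ⟨htI, ?_, hlast⟩
    rw [hsNorm_eq_of_lowPass s (hlow t htI), ← heq (Set.mem_univ t), boxEnergy_zero]
    simp
  · have h0 : √(boxEnergy s N U₀) ≤ m := by
      have := ofReal_sqrt_boxEnergy_le s N U₀
      rw [hmof] at this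
      exact (ENNReal.ofReal_le_ofReal_iff hm0.le).1 this
    have hgrow : ∀ x ∈ I, 0 ≤ x → x ≤ t →
        √(boxEnergy s N (U x)) ≤ m * Real.exp (2 * K * m * x) := fun x hx hx0 hxt =>
      hU.boxEnergy_le_exp hp hK (fun t ht => hbound N U₀ I U hU t ht) hm0 hmM h0 hx hx0
        (le_trans (by gcongr) hexp)
    obtain ⟨Q, hQ, hmem⟩ := exists_isCompact_lowPass (d := d) (n := n) (s := s) N (2 * m)
    have htI : t ∈ I := mem_of_forall_mem_isCompact (contDiff_filteredField N) hU
      (fun J V hV => (hmax J V hV).1) hQ ht0 fun x hx hx0 hxt =>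
        hmem _ (hlow x hx) (by linarith) ((hgrow x hx hx0 hxt).trans (by
          have : Real.exp (2 * K * m * x) ≤ Real.exp (2 * K * m * t) := by gcongr
          nlinarith))
    refine ⟨htI, ?_, hlast⟩
    rw [hsNorm_eq_of_lowPass s (hlow t htI), hmof, ← ENNReal.ofReal_mul hm0.le]
    exact ENNReal.ofReal_le_ofReal (hgrow t htI ht0 le_rfl)

theorem IsSolution.contDiffOneInHs
    (hp : ∀ j a b u, A j u a b = MvPolynomial.eval (fun i => u i) (p j a b))
    (h : IsSolution A s N U₀ I U) (s' : ℝ) : ContDiffOneInHs s' I U := by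
  have hU := h.isFlowLine hp
  have hlow := hU.sharpFilter_eq hp
  have hlowV : ∀ u : L2 d n, sharpFilter N (filteredField p N u) = filteredField p N u :=
    fun u => by
      rw [filteredField_eq hp, ← lowPass_apply, map_neg, lowPass_apply, sharpFilter_sharpFilter]
  have hc : ContinuousOn U I := fun t ht => (hU.hasDerivAt t ht).continuousAt.continuousWithinAt
  refine ⟨continuousInHs_of_lowPass s' hlow hc, fun t => filteredField p N (U t),
    continuousInHs_of_lowPass (N := N) s' (fun t _ => hlowV _)
      ((contDiff_filteredField N).continuous.comp_continuousOn hc), fun t ht => ?_⟩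
  refine tendsto_hsNorm_of_lowPass (N := N) s' ?_ ?_
  · have : ∀ᶠ r in 𝓝[≠] (0 : ℝ), t + r ∈ I := by
      have hcont : Tendsto (fun r : ℝ => t + r) (𝓝 0) (𝓝 t) := by
        simpa using (continuous_const.add continuous_id).tendsto (0 : ℝ) (f := fun r : ℝ => t + r)
      exact (hcont.mono_left nhdsWithin_le_nhds).eventually (hU.isOpen.mem_nhds ht)
    filter_upwards [this] with r hr
    rw [← lowPass_apply, map_sub, map_smul, map_sub, lowPass_apply, lowPass_apply, lowPass_apply,
      hlow _ hr, hlow t ht, hlowV]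
  · have := (hasDerivAt_iff_tendsto_slope_zero.1 (hU.hasDerivAt t ht)).sub_const
      (filteredField p N (U t))
    simpa using this

/-- A bound in `H^s` controls the growth of all higher Sobolev norms, uniformly in `N`. -/
theorem exists_higher_regularity_bound
    (hp : ∀ j a b u, A j u a b = MvPolynomial.eval (fun i => u i) (p j a b))
    (hsym : ∀ j a b, p j a b = p j b a) (hs : (d : ℝ) / 2 + 1 < s) {s' : ℝ} (hs' : s ≤ s')
    {M : ℝ} (hM : 0 < M) : ∃ C : ℝ, 0 < C ∧
      ∀ (N : ℕ) (U₀ : L2 d n) (I : Set ℝ) (U : ℝ → L2 d n), IsSolution A s N U₀ I U →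
        ∀ T ∈ I, (∀ t ∈ Set.Icc 0 T, hsNorm s (U t) ≤ ENNReal.ofReal M) →
          ∀ t ∈ Set.Icc 0 T,
            hsNorm s' (U t) ≤ hsNorm s' U₀ * ENNReal.ofReal (Real.exp (C * M * t)) := by
  have hd : (0 : ℝ) ≤ d := by positivity
  obtain ⟨K, hK, hbound⟩ := exists_abs_deriv_boxEnergy_le hp hsym hs (σ := s') (by linarith) M
  refine ⟨K, hK, fun N U₀ I U h T hT hle t ht => ?_⟩
  have hU := h.isFlowLine hp
  have hlow := hU.sharpFilter_eq hp
  have hsub := hU.Icc_subset hT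
  have hsqrt : ∀ x ∈ Set.Icc 0 T, √(boxEnergy s N (U x)) ≤ M := fun x hx => by
    have := hle x hx
    rw [hsNorm_eq_of_lowPass s (hlow x (hsub hx))] at this
    exact (ENNReal.ofReal_le_ofReal_iff hM.le).1 this
  have hder : ∀ x ∈ I, HasDerivAt (fun t => boxEnergy s' N (U t))
      (deriv (fun t => boxEnergy s' N (U t)) x) x := fun x hx =>
    (hU.hasDerivAt_boxEnergy hp s' hx).differentiableAt.hasDerivAt
  have key := norm_le_gronwallBound_of_norm_deriv_right_le
    (f := fun t => boxEnergy s' N (U t)) (f' := deriv fun t => boxEnergy s' N (U t))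
    (δ := boxEnergy s' N U₀) (K := K * M) (ε := 0) (a := 0) (b := T)
    (fun x hx => (hder x (hsub hx)).continuousAt.continuousWithinAt)
    (fun x hx => (hder x (hsub (Set.Ico_subset_Icc_self hx))).hasDerivWithinAt)
    (by rw [hU.boxEnergy_zero_eq, Real.norm_of_nonneg (boxEnergy_nonneg _ _ _)])
    (fun x hx => by
      have hx' := Set.Ico_subset_Icc_self hx
      rw [add_zero, Real.norm_eq_abs, Real.norm_of_nonneg (boxEnergy_nonneg _ _ _)]
      refine (hbound N U₀ I U hU x (hsub hx') (hsqrt x hx')).trans ?_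
      have := boxEnergy_nonneg s' N (U x)
      gcongr
      exact hsqrt x hx') t ht
  rw [gronwallBound_ε0, sub_zero, Real.norm_of_nonneg (boxEnergy_nonneg _ _ _)] at key
  rw [hsNorm_eq_of_lowPass s' (hlow t (hsub ht))]
  calc ENNReal.ofReal √(boxEnergy s' N (U t))
      ≤ ENNReal.ofReal (√(boxEnergy s' N U₀) * Real.exp (K * M * t)) := by
        refine ENNReal.ofReal_le_ofReal ((Real.sqrt_le_left (by positivity)).2 (key.trans ?_))
        rw [mul_pow, Real.sq_sqrt (boxEnergy_nonneg _ _ _)]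
        have h1 : 1 ≤ Real.exp (K * M * t) :=
          Real.one_le_exp (mul_nonneg (mul_nonneg hK.le hM.le) ht.1)
        exact mul_le_mul_of_nonneg_left (by nlinarith) (boxEnergy_nonneg _ _ _)
    _ = ENNReal.ofReal √(boxEnergy s' N U₀) * ENNReal.ofReal (Real.exp (K * M * t)) :=
        ENNReal.ofReal_mul (Real.sqrt_nonneg _)
    _ ≤ _ := by gcongr; exact ofReal_sqrt_boxEnergy_le s' N U₀

end Conclusions

end SpectralSymm

end

open SpectralSymm in
theorem proposition2p2 (d n : ℕ)
    (A : Fin d → EuclideanSpace ℝ (Fin n) → Matrix (Fin n) (Fin n) ℝ)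
    (hpoly : ∀ (j : Fin d) (a b : Fin n), ∃ p : MvPolynomial (Fin n) ℝ,
      ∀ u : EuclideanSpace ℝ (Fin n), A j u a b = MvPolynomial.eval (fun i => u i) p)
    (hsymm : ∀ (j : Fin d) (u : EuclideanSpace ℝ (Fin n)), (A j u).IsHermitian)
    (s : ℝ) (hs : (d : ℝ) / 2 + 1 < s) :
    -- existence, uniqueness and the bound in `H^s`, with `C` and `T` independent of `N` and `U⁰`
    (∀ M : ℝ, 0 < M → ∃ C : ℝ, 0 < C ∧ ∃ T : ℝ, 0 < T ∧
      ∀ (N : ℕ) (U₀ : L2 d n), hsNorm s U₀ ≤ ENNReal.ofReal M →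
        ∃ (I : Set ℝ) (U : ℝ → L2 d n),
          IsMaximalSolution A s N U₀ I U ∧
          (∀ (J : Set ℝ) (V : ℝ → L2 d n),
            IsMaximalSolution A s N U₀ J V → J = I ∧ Set.EqOn V U I) ∧
          ∀ t : ℝ, 0 ≤ t → t * (hsNorm s U₀).toReal ≤ T →
            t ∈ I ∧
            hsNorm s (U t) ≤
              hsNorm s U₀ * ENNReal.ofReal (Real.exp (C * (hsNorm s U₀).toReal * t)) ∧
            hsNorm s U₀ * ENNReal.ofReal (Real.exp (C * (hsNorm s U₀).toReal * t)) ≤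
              2 * hsNorm s U₀) ∧
    -- propagation of higher regularity
    (∀ s' : ℝ, s ≤ s' →
      (∀ (N : ℕ) (U₀ : L2 d n) (I : Set ℝ) (U : ℝ → L2 d n), MemHs s U₀ →
        IsMaximalSolution A s N U₀ I U → ContDiffOneInHs s' I U) ∧
      ∀ Mstar : ℝ, 0 < Mstar → ∃ Cstar : ℝ, 0 < Cstar ∧
        ∀ (N : ℕ) (U₀ : L2 d n) (I : Set ℝ) (U : ℝ → L2 d n), MemHs s U₀ →
          IsMaximalSolution A s N U₀ I U →
          ∀ Tstar ∈ I, 0 < Tstar →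
            (∀ t ∈ Set.Icc 0 Tstar, hsNorm s (U t) ≤ ENNReal.ofReal Mstar) →
            ∀ t ∈ Set.Icc 0 Tstar,
              hsNorm s' (U t) ≤
                hsNorm s' U₀ * ENNReal.ofReal (Real.exp (Cstar * Mstar * t))) := by
  choose p hp using hpoly
  have hp' : ∀ j a b u, A j u a b = MvPolynomial.eval (fun i => u i) (p j a b) := hp
  -- Real polynomials that agree at every point are equal.
  have hsym : ∀ j a b, p j a b = p j b a := fun j a b => MvPolynomial.funext fun x => by
    have h := (hsymm j (WithLp.toLp 2 x)).apply b a
    rw [hp, hp] at h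
    simpa using h
  refine ⟨fun M hM => exists_uniform_bound hp' hsym hs hM, fun s' hs' =>
    ⟨fun N U₀ I U _ hU => hU.1.contDiffOneInHs hp' s', fun M hM => ?_⟩⟩
  obtain ⟨C, hC, h⟩ := exists_higher_regularity_bound hp' hsym hs hs' hM
  exact ⟨C, hC, fun N U₀ I U _ hU T hT _ hle => h N U₀ I U hU.1 T hT hle⟩
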